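/- Let $\log$ denote the principal logarithm ($-\pi<\arg\le\pi$) and let $z^w=e^{w\log z}$ for $z\ne0$, with $0^w=0$ for $w\neq 0$ and $0^0=1$. For $q\in\mathbb C$ let $\zeta(s,q)$ be the Hurwitz zeta function, that is, the analytic continuation in $s$ to $\mathbb C\setminus\{1\}$ of $\sum_{n\ge0}(n+q)^{-s}$, $\operatorname{Re}s>1$ (if $q\in\{0,-1,-2,\dots\}$, the term with $n+q=0$ is omitted). Let $k\in\mathbb C\setminus\{-1,-2\}$, let $b\in\mathbb C$ with $b\ne0$ and $\operatorname{Re}b\ge0$, and let $a\in\mathbb C$, $a\neq0$, be such that at least one of the following holds: (i) $0<\arg a\le\pi$; (ii) $a>0$ and $\operatorname{Re}k>-1$; (iii) $k$ is a nonnegative integer. Then the integral below converges absolutely, and $$\int_{0}^{\infty}\frac{\log\left(\frac{(x+1)(b^2+x)}{(b+x)^2}\right)\log^k(ax)}{x}\,dx =\frac{2^{k+3}(i\pi)^{k+2}}{k+1}\,\zeta\!\left(-k-1,\frac{-i\log a-i\log b+\pi}{2\pi}\right) -\frac{(2i\pi)^{k+2}}{k+1}\,\zeta\!\left(-k-1,\frac{-i\log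 a-2i\log b+\pi}{2\pi}\right) -\frac{(2i\pi)^{k+2}}{k+1}\,\zeta\!\left(-k-1,\frac{\pi-i\log a}{2\pi}\right).$$ -/

import Mathlib

/-- `Z` is the Hurwitz zeta function `s ↦ ζ(s, q)`: it is holomorphic on `ℂ \ {1}` and, for
`Re s > 1`, it is the sum of the series `∑ n ≥ 0, (n + q) ^ (-s)` with principal powers.
By the identity theorem, these conditions determine `Z` on `ℂ \ {1}`.
(If `q` is `0` or a negative integer, the single term with `n + q = 0` is omitted: it is `0` here,
because `(0 : ℂ) ^ s = 0` for `s ≠ 0` and `1 / 0 = 0`.) -/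
def IsHurwitzZeta (q : ℂ) (Z : ℂ → ℂ) : Prop :=
  DifferentiableOn ℂ Z {1}ᶜ ∧
    ∀ s : ℂ, 1 < s.re → Z s = ∑' n : ℕ, 1 / ((n : ℂ) + q) ^ s

open Classical in
/-- The Hurwitz zeta function `ζ(s, q)` with complex second argument, as the analytic continuation
in `s` of `∑ n ≥ 0, (n + q) ^ (-s)`; the value at the pole `s = 1` carries no meaning. -/
noncomputable def hurwitzZetaC (s q : ℂ) : ℂ :=
  if h : ∃ Z : ℂ → ℂ, IsHurwitzZeta q Z then h.choose s else 0

/-- The integrand `log ((x+1)(b²+x)/(b+x)²) * log(a x)^k / x`, with principal logarithms and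
principal powers. -/
noncomputable def logIntegrand (k a b : ℂ) (x : ℝ) : ℂ :=
  Complex.log (((x : ℂ) + 1) * (b ^ 2 + (x : ℂ)) / (b + (x : ℂ)) ^ 2)
    * Complex.log (a * (x : ℂ)) ^ k / (x : ℂ)

open Complex Filter Topology Set MeasureTheory

/-! Put x = e^t and α = log a. Since x > 0, log(ax) = α + t, so the integral becomes ∫ log R(e^t) (α
+ t)^k dt over ℝ, where R is `logRatio b`. Up to branch constants, log R(e^t) is log(1 + e^t) +
log(b² + e^t) - 2 log(b + e^t), and its second derivative is K_1 + K_{b²} - 2 K_b with K_B(t) = B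
e^t / (B + e^t)² (`logisticKernel`). For Im α > 0 and Re b > 0, two integrations by parts therefore
reduce everything to the moments M_p(α, B) = ∫ (α + t)^p K_B(t) dt with p = k + 2.

K_B is 2πi-periodic and has one double pole, at log B + πi, in the strip 0 ≤ Im z ≤ 2π. Shifting the
contour by 2πi gives M_p(α) - M_p(α + 2πi) = -2πi p (α + log B + πi)^(p-1) (`logisticMoment_sub`).
Iterating when Re p < 0 produces the Hurwitz series: M_p = -p (2πi)^p ζ(1 - p, (α + log B +
πi)/(2πi)). The moment is entire in p, so it is itself the analytic continuation, and the identity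
persists for all p ≠ 0 (`mul_hurwitzZetaC_eq_neg_logisticMoment`). The same formula with B = 1
proves that ζ(s, q) exists when Re q > 1/2; the shift q → q + 1 reaches the other q.

The remaining parameters are limits or identities of polynomials. For Im α = 0 or Re b = 0, α is
raised by εi and b is rotated towards the positive axis; dominated convergence on the integral meets
continuity of ζ(s, ·) on Re q ≥ 0 (`integral_log_logRatio_mul`). For k a nonnegative integer both
sides are polynomials in α, so agreement on the upper half-plane gives agreement everywhere
(`integral_log_logRatio_mul_natCast`). -/

/-! ### Uniqueness of the Hurwitz zeta function and the shift q → q + 1 -/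

theorem IsHurwitzZeta.eqOn {q : ℂ} {Z W : ℂ → ℂ} (hZ : IsHurwitzZeta q Z)
    (hW : IsHurwitzZeta q W) : EqOn Z W {1}ᶜ := by
  have hopen : IsOpen ({1}ᶜ : Set ℂ) := isOpen_compl_singleton
  refine (hZ.1.analyticOnNhd hopen).eqOn_of_preconnected_of_eventuallyEq
    (hW.1.analyticOnNhd hopen) (z₀ := 2) ?_ (by norm_num) ?_
  · exact (isConnected_compl_singleton_of_one_lt_rank (by simp) (1 : ℂ)).isPreconnected
  · have : {s : ℂ | 1 < s.re} ∈ 𝓝 (2 : ℂ) :=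
      (isOpen_lt continuous_const continuous_re).mem_nhds (by norm_num)
    filter_upwards [this] with s hs
    rw [hZ.2 s hs, hW.2 s hs]

/-- `hurwitzZetaC` is an arbitrary choice of continuation; by uniqueness any explicit continuation
computes it. -/
theorem IsHurwitzZeta.hurwitzZetaC_eq {q : ℂ} {Z : ℂ → ℂ} (hZ : IsHurwitzZeta q Z) {s : ℂ}
    (hs : s ≠ 1) : hurwitzZetaC s q = Z s := by
  have h : ∃ Z : ℂ → ℂ, IsHurwitzZeta q Z := ⟨Z, hZ⟩
  rw [hurwitzZetaC, dif_pos h]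
  exact h.choose_spec.eqOn hZ hs

theorem summable_one_div_natCast_add_cpow (q : ℂ) {s : ℂ} (hs : 1 < s.re) :
    Summable fun n : ℕ => 1 / ((n : ℂ) + q) ^ s := by
  have hs0 : s ≠ 0 := fun h => by simp [h] at hs; linarith
  have hsum : Summable fun n : ℕ => (n : ℝ) ^ (-s.re) :=
    Real.summable_nat_rpow.mpr (by linarith)
  refine summable_of_isBigO_nat hsum ?_
  refine Asymptotics.IsBigO.of_bound (Real.exp (Real.pi * |s.im|) * (2 : ℝ) ^ s.re) ?_
  filter_upwards [eventually_ge_atTop (⌈2 * ‖q‖⌉₊ + 1)] with n hn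
  have hn1 : 2 * ‖q‖ ≤ n := (Nat.le_ceil _).trans (by exact_mod_cast (by omega))
  have hn0 : (0 : ℝ) < n := by exact_mod_cast (by omega)
  have hnorm : (n : ℝ) / 2 ≤ ‖(n : ℂ) + q‖ := by
    have := norm_sub_le ((n : ℂ) + q) q
    simp only [add_sub_cancel_right, norm_natCast] at this
    linarith
  have hne : (n : ℂ) + q ≠ 0 := fun h => by rw [h, norm_zero] at hnorm; linarith
  rw [norm_div, norm_one, norm_cpow_of_ne_zero hne, Real.norm_of_nonneg (by positivity),
    one_div_div]
  have h1 : Real.exp (arg ((n : ℂ) + q) * s.im) ≤ Real.exp (Real.pi * |s.im|) := by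
    apply Real.exp_le_exp.mpr
    calc _ ≤ |arg ((n : ℂ) + q) * s.im| := le_abs_self _
      _ = |arg ((n : ℂ) + q)| * |s.im| := abs_mul _ _
      _ ≤ _ := by gcongr; exact abs_arg_le_pi _
  have h2 : ((n : ℝ) / 2) ^ s.re ≤ ‖(n : ℂ) + q‖ ^ s.re :=
    Real.rpow_le_rpow (by positivity) hnorm (by linarith)
  rw [Real.div_rpow hn0.le (by norm_num)] at h2
  have hn' : 0 < (n : ℝ) ^ s.re := Real.rpow_pos_of_pos hn0 _
  have h2' : 0 < (2 : ℝ) ^ s.re := by positivity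
  rw [Real.rpow_neg hn0.le]
  calc _ ≤ Real.exp (Real.pi * |s.im|) / ((n : ℝ) ^ s.re / 2 ^ s.re) := by gcongr
    _ = _ := by field_simp

theorem tsum_one_div_natCast_add_cpow (q : ℂ) {s : ℂ} (hs : 1 < s.re) :
    ∑' n : ℕ, 1 / ((n : ℂ) + q) ^ s = 1 / q ^ s + ∑' n : ℕ, 1 / ((n : ℂ) + (q + 1)) ^ s := by
  rw [(summable_one_div_natCast_add_cpow q hs).tsum_eq_zero_add]
  simp only [Nat.cast_zero, zero_add, Nat.cast_add, Nat.cast_one]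
  congr 2
  ext n
  rw [add_assoc, add_comm 1 q]

/-- Splitting off the term n = 0. At q = 0 this term must be replaced by the zero function: since
0^0 = 1, the function s ↦ 1 / 0^s jumps at s = 0 and is not holomorphic there. -/
theorem IsHurwitzZeta.of_add_one {q : ℂ} {Z : ℂ → ℂ} (hZ : IsHurwitzZeta (q + 1) Z) :
    IsHurwitzZeta q fun s => (if q = 0 then 0 else 1 / q ^ s) + Z s := by
  constructor
  · split_ifs with hq
    · simpa using hZ.1
    · refine DifferentiableOn.add (fun s _ => ?_) hZ.1
      have h1 : DifferentiableAt ℂ (fun s : ℂ => q ^ s) s := differentiableAt_id.const_cpow (.inl hq)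
      have h2 : q ^ s ≠ 0 := by simp [cpow_eq_zero_iff, hq]
      exact ((differentiableAt_const _).div h1 h2).differentiableWithinAt
  · intro s hs
    have hs0 : s ≠ 0 := fun h => by simp [h] at hs; linarith
    simp only [tsum_one_div_natCast_add_cpow q hs, hZ.2 s hs]
    split_ifs with hq
    · simp [hq, zero_cpow hs0]
    · rfl

/-- Finitely many unit shifts move any q into Re q > 1/2, the half-plane where the moment with B = 1
represents ζ(s, q). -/
theorem exists_isHurwitzZeta_of_re_large
    (h : ∀ q : ℂ, 1 / 2 < q.re → ∃ Z, IsHurwitzZeta q Z) (q : ℂ) : ∃ Z, IsHurwitzZeta q Z := by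
  have key : ∀ N : ℕ, ∀ q : ℂ, 1 / 2 - (N : ℝ) < q.re → ∃ Z, IsHurwitzZeta q Z := by
    intro N
    induction N with
    | zero => intro q hq; exact h q (by simpa using hq)
    | succ N ih =>
      intro q hq
      obtain ⟨Z, hZ⟩ := ih (q + 1) (by push_cast at hq; simp; linarith)
      exact ⟨_, hZ.of_add_one⟩
  obtain ⟨N, hN⟩ := exists_nat_gt (1 / 2 - q.re)
  exact key N q (by linarith)

theorem hurwitzZetaC_eq_add_one (h : ∀ q : ℂ, ∃ Z, IsHurwitzZeta q Z) {s : ℂ}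
    (hs : s ≠ 1) (hs0 : s ≠ 0) (q : ℂ) :
    hurwitzZetaC s q = q ^ (-s) + hurwitzZetaC s (q + 1) := by
  obtain ⟨Z, hZ⟩ := h (q + 1)
  rw [hZ.of_add_one.hurwitzZetaC_eq hs, hZ.hurwitzZetaC_eq hs]
  split_ifs with hq
  · rw [hq, zero_cpow (neg_ne_zero.mpr hs0)]
  · rw [cpow_neg, one_div]

/-! ### Exponential bounds for complex powers -/

theorem norm_cpow_le_rpow_mul_exp (z p : ℂ) :
    ‖z ^ p‖ ≤ ‖z‖ ^ p.re * Real.exp (Real.pi * |p.im|) := by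
  refine (norm_cpow_le z p).trans ?_
  rw [div_eq_mul_inv, ← Real.exp_neg]
  gcongr
  calc _ ≤ |-(arg z * p.im)| := le_abs_self _
    _ = |arg z| * |p.im| := by rw [abs_neg, abs_mul]
    _ ≤ _ := by gcongr; exact abs_arg_le_pi _

theorem exists_add_abs_rpow_le_exp {A M ε : ℝ} (hA : 0 ≤ A) (hM : 0 ≤ M) (hε : 0 < ε) :
    ∃ C, 0 ≤ C ∧ ∀ t : ℝ, (A + |t|) ^ M ≤ C * Real.exp (ε * |t|) := by
  -- This d satisfies d * M ≤ ε, so an exponential bound for A + |t| at rate d survives the M-th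
  -- power.
  set d := ε / (M + 1) with hd
  have hd0 : 0 < d := by positivity
  refine ⟨(A + 1 / d) ^ M, by positivity, fun t => ?_⟩
  have h1 : A + |t| ≤ (A + 1 / d) * Real.exp (d * |t|) := by
    have h2 : d * |t| ≤ Real.exp (d * |t|) := by
      have := Real.add_one_le_exp (d * |t|); linarith
    have h3 : 1 ≤ Real.exp (d * |t|) := Real.one_le_exp (by positivity)
    have h4 : |t| ≤ 1 / d * Real.exp (d * |t|) := by
      rw [div_mul_eq_mul_div, one_mul, le_div_iff₀ hd0]; linarith
    nlinarith
  calc (A + |t|) ^ M ≤ ((A + 1 / d) * Real.exp (d * |t|)) ^ M :=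
        Real.rpow_le_rpow (by positivity) h1 hM
    _ = (A + 1 / d) ^ M * Real.exp (d * |t| * M) := by
        rw [Real.mul_rpow (by positivity) (by positivity), Real.exp_mul (d * |t|) M]
    _ ≤ _ := by
        have : d * M ≤ ε := by
          rw [hd, div_mul_eq_mul_div, div_le_iff₀ (by positivity)]; nlinarith
        refine mul_le_mul_of_nonneg_left (Real.exp_le_exp.mpr ?_) (by positivity)
        nlinarith [abs_nonneg t]

/-- The constant is uniform in z and in ‖p‖ ≤ M, which is what domination needs when p or α varies.
-/
theorem exists_norm_cpow_le_exp {η A M ε : ℝ} (hη : 0 < η) (hA : 0 ≤ A) (hM : 0 ≤ M)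
    (hε : 0 < ε) :
    ∃ C, 0 ≤ C ∧ ∀ (z p : ℂ) (t : ℝ), η ≤ ‖z‖ → ‖z‖ ≤ A + |t| → ‖p‖ ≤ M →
      ‖z ^ p‖ ≤ C * Real.exp (ε * |t|) := by
  obtain ⟨C, hC0, hC⟩ := exists_add_abs_rpow_le_exp (A := 1 + A) (by positivity) hM hε
  refine ⟨(1 + 1 / η) ^ M * C * Real.exp (Real.pi * M), by positivity, fun z p t h1 h2 hp => ?_⟩
  have hz : 0 < ‖z‖ := hη.trans_le h1
  -- The base (1 + 1/η)(1 + A + |t|) dominates 1, ‖z‖ and ‖z‖⁻¹ at once, so both signs of Re p are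
  -- covered.
  have hX : ‖z‖ ^ p.re ≤ ((1 + 1 / η) * (1 + A + |t|)) ^ M := by
    have hX1 : 1 ≤ (1 + 1 / η) * (1 + A + |t|) := by
      have : 0 < 1 / η := by positivity
      nlinarith [abs_nonneg t, mul_nonneg this.le (add_nonneg hA (abs_nonneg t))]
    have hXz : ‖z‖ ≤ (1 + 1 / η) * (1 + A + |t|) := by
      have : 0 < 1 / η := by positivity
      nlinarith [abs_nonneg t, mul_nonneg this.le (add_nonneg hA (abs_nonneg t))]
    have hXz' : ‖z‖⁻¹ ≤ (1 + 1 / η) * (1 + A + |t|) := by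
      have h3 : ‖z‖⁻¹ ≤ 1 / η := by rw [one_div]; gcongr
      have : 0 < 1 / η := by positivity
      nlinarith [abs_nonneg t, mul_nonneg this.le (add_nonneg hA (abs_nonneg t))]
    have hre : |p.re| ≤ M := (abs_re_le_norm p).trans hp
    rcases le_total 0 p.re with h | h
    · calc _ ≤ ((1 + 1 / η) * (1 + A + |t|)) ^ p.re := Real.rpow_le_rpow hz.le hXz h
        _ ≤ _ := Real.rpow_le_rpow_of_exponent_le hX1 ((le_abs_self _).trans hre)
    · calc _ = (‖z‖⁻¹) ^ (-p.re) := by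
            rw [Real.inv_rpow hz.le, Real.rpow_neg hz.le, inv_inv]
        _ ≤ ((1 + 1 / η) * (1 + A + |t|)) ^ (-p.re) :=
            Real.rpow_le_rpow (by positivity) hXz' (by linarith)
        _ ≤ _ := Real.rpow_le_rpow_of_exponent_le hX1 ((neg_le_abs _).trans hre)
  have him : |p.im| ≤ M := (abs_im_le_norm p).trans hp
  rw [Real.mul_rpow (by positivity) (by positivity)] at hX
  calc _ ≤ _ := norm_cpow_le_rpow_mul_exp z p
    _ ≤ ((1 + 1 / η) ^ M * (C * Real.exp (ε * |t|))) * Real.exp (Real.pi * M) := by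
        gcongr
        · exact hX.trans (by gcongr; exact hC t)
    _ = _ := by ring

theorem integrable_exp_neg_mul_abs {d : ℝ} (hd : 0 < d) :
    Integrable fun t : ℝ => Real.exp (-d * |t|) := by
  have h1 : IntegrableOn (fun t : ℝ => Real.exp (-d * |t|)) (Iic 0) := by
    refine (integrableOn_exp_mul_Iic hd 0).congr_fun (fun t ht => ?_) measurableSet_Iic
    simp [abs_of_nonpos (mem_Iic.mp ht)]
  have h2 : IntegrableOn (fun t : ℝ => Real.exp (-d * |t|)) (Ioi 0) := by
    refine (integrableOn_exp_mul_Ioi (neg_neg_of_pos hd) 0).congr_fun (fun t ht => ?_)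
      measurableSet_Ioi
    simp [abs_of_pos (mem_Ioi.mp ht)]
  rw [← integrableOn_univ, ← Iic_union_Ioi (a := (0 : ℝ))]
  exact h1.union h2

/-! ### The logistic kernel on the real line and off it -/

/-- The derivative of the logistic function `e ^ z / (B + e ^ z)`. -/
noncomputable def logisticKernel (B z : ℂ) : ℂ := B * exp z / (B + exp z) ^ 2

theorem exists_le_norm_add_ofReal {B : ℂ} (hB : B ∈ slitPlane) :
    ∃ κ : ℝ, 0 < κ ∧ ∀ x : ℝ, 0 ≤ x → κ * (1 + x) ≤ ‖B + x‖ := by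
  have hB0 : 0 < ‖B‖ := norm_pos_iff.mpr (slitPlane_ne_zero hB)
  have hre : -‖B‖ < B.re := by
    rcases hB with h | h
    · linarith
    · exact (abs_lt.mp (abs_re_lt_norm.mpr h)).1
  have hre' : B.re ≤ ‖B‖ := re_le_norm B
  -- c = cos²(arg B / 2), positive because B is off the cut. The bound below then rests on ‖B + x‖²
  -- - c(‖B‖ + x)² = (1 - c)(‖B‖ - x)².
  set c := (1 + B.re / ‖B‖) / 2 with hc
  have hBc : B.re = (2 * c - 1) * ‖B‖ := by rw [hc]; field_simp; ring
  have hc0 : 0 < c := by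
    have : -1 < B.re / ‖B‖ := by rw [lt_div_iff₀ hB0]; linarith
    rw [hc]; linarith
  have hc1 : c ≤ 1 := by
    have : B.re / ‖B‖ ≤ 1 := by rw [div_le_one hB0]; exact hre'
    rw [hc]; linarith
  have hm : 0 < min 1 ‖B‖ := lt_min one_pos hB0
  refine ⟨Real.sqrt c * min 1 ‖B‖, mul_pos (Real.sqrt_pos.mpr hc0) hm, fun x hx => ?_⟩
  have h1 : Real.sqrt c * (‖B‖ + x) ≤ ‖B + x‖ := by
    refine abs_le_of_sq_le_sq' ?_ (norm_nonneg _) |>.2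
    rw [mul_pow, Real.sq_sqrt hc0.le, ← normSq_eq_norm_sq]
    have h2 : normSq (B + x) = ‖B‖ ^ 2 + 2 * x * B.re + x ^ 2 := by
      rw [← normSq_eq_norm_sq, normSq_apply, normSq_apply]; simp; ring
    rw [h2, hBc]
    nlinarith [mul_nonneg (sub_nonneg.mpr hc1) (sq_nonneg (‖B‖ - x))]
  refine le_trans ?_ h1
  rw [mul_assoc]
  gcongr
  have := min_le_left 1 ‖B‖
  have := min_le_right 1 ‖B‖
  nlinarith

theorem exp_div_one_add_exp_sq_le (t : ℝ) :
    Real.exp t / (1 + Real.exp t) ^ 2 ≤ Real.exp (-|t|) := by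
  have h := Real.exp_pos t
  rw [div_le_iff₀ (by positivity)]
  rcases le_total 0 t with ht | ht
  · rw [abs_of_nonneg ht, Real.exp_neg]
    field_simp
    nlinarith
  · rw [abs_of_nonpos ht, neg_neg]
    nlinarith [mul_pos h h, mul_pos h (mul_pos h h)]

theorem exists_norm_logisticKernel_ofReal_le {B : ℂ} (hB : B ∈ slitPlane) :
    ∃ C, 0 ≤ C ∧ ∀ t : ℝ, ‖logisticKernel B t‖ ≤ C * Real.exp (-|t|) := by
  obtain ⟨κ, hκ, h⟩ := exists_le_norm_add_ofReal hB
  refine ⟨‖B‖ / κ ^ 2, by positivity, fun t => ?_⟩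
  have h1 := h (Real.exp t) (Real.exp_pos t).le
  rw [logisticKernel, norm_div, norm_mul, norm_pow, ← ofReal_exp, norm_real, Real.norm_of_nonneg
    (Real.exp_pos t).le]
  have hpos := Real.exp_pos t
  calc _ ≤ ‖B‖ * Real.exp t / (κ * (1 + Real.exp t)) ^ 2 := by gcongr
    _ = ‖B‖ / κ ^ 2 * (Real.exp t / (1 + Real.exp t) ^ 2) := by field_simp
    _ ≤ _ := by gcongr; exact exp_div_one_add_exp_sq_le t

/-- Away from the real axis the kernel has poles, all on the line Re z = log ‖B‖, so decay is
claimed only for large |Re z|. It serves the vertical sides of the contour. -/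
theorem exists_norm_logisticKernel_le {B : ℂ} (hB : B ≠ 0) :
    ∃ C R, 0 ≤ C ∧ ∀ z : ℂ, R ≤ |z.re| → ‖logisticKernel B z‖ ≤ C * Real.exp (-|z.re|) := by
  have hB0 : 0 < ‖B‖ := norm_pos_iff.mpr hB
  refine ⟨4 * ‖B‖ + 4 / ‖B‖, Real.log (2 * ‖B‖ + 2 / ‖B‖), by positivity, fun z hz => ?_⟩
  have hz' : 2 * ‖B‖ + 2 / ‖B‖ ≤ Real.exp |z.re| := by
    rwa [← Real.log_le_iff_le_exp (by positivity)]
  have hpos : 0 < 2 / ‖B‖ := by positivity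
  rw [logisticKernel, norm_div, norm_mul, norm_pow, norm_exp]
  rcases le_total 0 z.re with h | h
  · rw [abs_of_nonneg h] at hz' ⊢
    have h1 : Real.exp z.re / 2 ≤ ‖B + exp z‖ := by
      have := norm_sub_le (B + exp z) B
      rw [add_sub_cancel_left, norm_exp] at this
      linarith
    have := Real.exp_pos z.re
    calc _ ≤ ‖B‖ * Real.exp z.re / (Real.exp z.re / 2) ^ 2 := by gcongr
      _ = 4 * ‖B‖ * Real.exp (-z.re) := by rw [Real.exp_neg]; field_simp; ring
      _ ≤ _ := by gcongr; linarith [show 0 < 4 / ‖B‖ by positivity]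
  · rw [abs_of_nonpos h] at hz' ⊢
    have h1 : ‖B‖ / 2 ≤ ‖B + exp z‖ := by
      have := norm_sub_le (B + exp z) (exp z)
      rw [add_sub_cancel_right, norm_exp] at this
      have h2 : Real.exp z.re ≤ ‖B‖ / 2 := by
        rw [Real.exp_neg] at hz'
        have h3 : 2 / ‖B‖ ≤ (Real.exp z.re)⁻¹ := by linarith
        rw [← inv_inv (Real.exp z.re), show ‖B‖ / 2 = (2 / ‖B‖)⁻¹ by rw [inv_div]]
        gcongr
      linarith
    rw [neg_neg]
    have := Real.exp_pos z.re
    calc _ ≤ ‖B‖ * Real.exp z.re / (‖B‖ / 2) ^ 2 := by gcongr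
      _ = 4 / ‖B‖ * Real.exp z.re := by field_simp; ring
      _ ≤ _ := by gcongr; linarith

theorem add_exp_ne_zero {B : ℂ} (hB : B ∈ slitPlane) (t : ℝ) : B + exp t ≠ 0 := by
  obtain ⟨κ, hκ, h⟩ := exists_le_norm_add_ofReal hB
  have h1 := h (Real.exp t) (Real.exp_pos t).le
  rw [ofReal_exp] at h1
  have := Real.exp_pos t
  exact norm_pos_iff.mp (lt_of_lt_of_le (by positivity) h1)

theorem continuous_logisticKernel_ofReal {B : ℂ} (hB : B ∈ slitPlane) :
    Continuous fun t : ℝ => logisticKernel B t := by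
  unfold logisticKernel
  refine Continuous.div (by fun_prop) (by fun_prop) fun t => pow_ne_zero 2 (add_exp_ne_zero hB t)

/-- A closed period strip contains exactly one pole, and it is interior because B is off the cut. -/
theorem eq_log_add_pi_of_add_exp_eq_zero {B z : ℂ} (hB : B ∈ slitPlane) (h0 : 0 ≤ z.im)
    (h1 : z.im ≤ 2 * Real.pi) (hz : B + exp z = 0) : z = log B + Real.pi * I := by
  have hexp : exp (z - Real.pi * I) = B := by
    rw [exp_sub, exp_pi_mul_I]
    linear_combination -hz
  have him : (z - Real.pi * I).im = z.im - Real.pi := by simp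
  rcases h0.eq_or_lt with h | h
  · exfalso
    have hzr : z = z.re := Complex.ext rfl (by simpa using h.symm)
    rw [hzr] at hz
    exact add_exp_ne_zero hB _ hz
  · rw [← hexp, log_exp (by rw [him]; linarith) (by rw [him]; linarith)]
    ring

theorem integrable_of_norm_le_exp {φ : ℝ → ℂ} (hφ : AEStronglyMeasurable φ) {C d : ℝ} (hd : 0 < d)
    (h : ∀ t, ‖φ t‖ ≤ C * Real.exp (-d * |t|)) : Integrable φ :=
  ((integrable_exp_neg_mul_abs hd).const_mul C).mono' hφ (ae_of_all _ h)

theorem integrable_mul_of_norm_le_exp {φ ψ : ℝ → ℂ} (hφ : AEStronglyMeasurable φ)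
    (hψ : AEStronglyMeasurable ψ) {C D : ℝ} (hφC : ∀ t, ‖φ t‖ ≤ C * Real.exp (1 / 2 * |t|))
    (hψD : ∀ t, ‖ψ t‖ ≤ D * Real.exp (-|t|)) : Integrable fun t => φ t * ψ t := by
  refine integrable_of_norm_le_exp (hφ.mul hψ) (C := C * D) (d := 1 / 2) (by norm_num) fun t => ?_
  rw [norm_mul]
  calc _ ≤ (C * Real.exp (1 / 2 * |t|)) * (D * Real.exp (-|t|)) :=
        mul_le_mul (hφC t) (hψD t) (norm_nonneg _) ((norm_nonneg _).trans (hφC t))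
    _ = C * D * (Real.exp (1 / 2 * |t|) * Real.exp (-|t|)) := by ring
    _ = _ := by rw [← Real.exp_add]; ring_nf

theorem add_mem_slitPlane_of_im_pos {α z : ℂ} (h : 0 < (α + z).im) : α + z ∈ slitPlane :=
  .inr h.ne'

theorem continuous_add_ofReal_cpow {α : ℂ} (hα : 0 < α.im) (p : ℂ) :
    Continuous fun t : ℝ => (α + t) ^ p :=
  Continuous.cpow (by fun_prop) continuous_const
    fun t => add_mem_slitPlane_of_im_pos (by simpa using hα)

theorem exists_norm_add_cpow_le {α : ℂ} (hα : 0 < α.im) (p : ℂ) {ε : ℝ} (hε : 0 < ε) (A : ℝ)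
    (hA : 0 ≤ A) :
    ∃ C, 0 ≤ C ∧ ∀ z : ℂ, 0 ≤ z.im → z.im ≤ A → ‖(α + z) ^ p‖ ≤ C * Real.exp (ε * |z.re|) := by
  obtain ⟨C, hC0, hC⟩ := exists_norm_cpow_le_exp hα (A := ‖α‖ + A) (by positivity)
    (norm_nonneg p) hε
  refine ⟨C, hC0, fun z h0 h1 => hC _ p _ ?_ ?_ le_rfl⟩
  · calc α.im ≤ (α + z).im := by simp [h0]
      _ ≤ _ := (le_abs_self _).trans (abs_im_le_norm _)
  · have := norm_le_abs_re_add_abs_im z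
    rw [abs_of_nonneg h0] at this
    linarith [norm_add_le α z]

theorem exists_norm_add_ofReal_cpow_le {α : ℂ} (hα : 0 < α.im) (p : ℂ) {ε : ℝ} (hε : 0 < ε) :
    ∃ C, 0 ≤ C ∧ ∀ t : ℝ, ‖(α + t) ^ p‖ ≤ C * Real.exp (ε * |t|) := by
  obtain ⟨C, hC0, hC⟩ := exists_norm_add_cpow_le hα p hε 0 le_rfl
  exact ⟨C, hC0, fun t => by simpa using hC t (by simp) (by simp)⟩

theorem integrable_add_cpow_mul_logisticKernel {α B : ℂ} (hα : 0 < α.im) (hB : B ∈ slitPlane)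
    (p : ℂ) : Integrable fun t : ℝ => (α + t) ^ p * logisticKernel B t := by
  obtain ⟨C, -, hC⟩ := exists_norm_add_ofReal_cpow_le hα p (ε := 1 / 2) (by norm_num)
  obtain ⟨D, -, hD⟩ := exists_norm_logisticKernel_ofReal_le hB
  exact integrable_mul_of_norm_le_exp (continuous_add_ofReal_cpow hα p).aestronglyMeasurable
    (continuous_logisticKernel_ofReal hB).aestronglyMeasurable hC hD

theorem integrable_logisticKernel {B : ℂ} (hB : B ∈ slitPlane) :
    Integrable fun t : ℝ => logisticKernel B t := by
  obtain ⟨D, -, hD⟩ := exists_norm_logisticKernel_ofReal_le hB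
  exact integrable_of_norm_le_exp (continuous_logisticKernel_ofReal hB).aestronglyMeasurable
    (d := 1) one_pos (by simpa using hD)

theorem hasDerivAt_exp_div_add_exp {B : ℂ} (hB : B ∈ slitPlane) (t : ℝ) :
    HasDerivAt (fun t : ℝ => exp t / (B + exp t)) (logisticKernel B t) t := by
  have h1 : HasDerivAt (fun t : ℝ => exp (t : ℂ)) (exp t) t := by
    simpa using (hasDerivAt_exp (t : ℂ)).comp_ofReal
  have h2 := h1.div (h1.const_add B) (add_exp_ne_zero hB t)
  refine h2.congr_deriv ?_
  rw [logisticKernel]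
  ring

theorem integral_logisticKernel {B : ℂ} (hB : B ∈ slitPlane) :
    ∫ t : ℝ, logisticKernel B t = 1 := by
  have h0 := slitPlane_ne_zero hB
  have hbot : Tendsto (fun t : ℝ => exp (t : ℂ)) atBot (𝓝 0) := by
    rw [tendsto_zero_iff_norm_tendsto_zero]
    simpa [norm_exp] using Real.tendsto_exp_atBot
  have hlim0 : Tendsto (fun t : ℝ => exp (t : ℂ) / (B + exp t)) atBot (𝓝 0) := by
    have := hbot.div (hbot.const_add B) (by simpa using h0)
    simpa [Pi.div_def] using this
  have hlim1 : Tendsto (fun t : ℝ => exp (t : ℂ) / (B + exp t)) atTop (𝓝 1) := by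
    have h1 : Tendsto (fun t : ℝ => exp (-(t : ℂ))) atTop (𝓝 0) := by
      simpa [Function.comp_def] using hbot.comp tendsto_neg_atTop_atBot
    have h2 : Tendsto (fun t : ℝ => 1 / (B * exp (-(t : ℂ)) + 1)) atTop (𝓝 1) := by
      have := (tendsto_const_nhds (x := (1 : ℂ))).div ((h1.const_mul B).add_const 1) (by simp)
      simpa [Pi.div_def] using this
    refine h2.congr fun t => ?_
    have h3 := exp_ne_zero (t : ℂ)
    rw [exp_neg]
    field_simp
  rw [integral_of_hasDerivAt_of_tendsto (hasDerivAt_exp_div_add_exp hB)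
    (integrable_logisticKernel hB) hlim0 hlim1, sub_zero]

/-! ### Shifting the contour by 2πi -/

theorem logisticKernel_add_two_pi_I (B z : ℂ) :
    logisticKernel B (z + 2 * Real.pi * I) = logisticKernel B z := by
  rw [logisticKernel, logisticKernel, exp_periodic]

/-- A double zero of g cancels the double pole of the kernel; the o((z - z₀)⁻¹) form is the
hypothesis of the removable singularity theorem. -/
theorem logisticKernel_isLittleO {B z₀ : ℂ} (hB : B ≠ 0) (hz : B + exp z₀ = 0) {g : ℂ → ℂ}
    (hg0 : g z₀ = 0) (hg : HasDerivAt g 0 z₀) :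
    (fun z => g z * logisticKernel B z - g z₀ * logisticKernel B z₀) =o[𝓝[≠] z₀]
      fun z => (z - z₀)⁻¹ := by
  have h1 := hasDerivAt_iff_tendsto_slope.mp hg
  have h2 := hasDerivAt_iff_tendsto_slope.mp ((hasDerivAt_exp z₀).const_add B)
  have h3 : Tendsto (fun z => B * exp z) (𝓝[≠] z₀) (𝓝 (B * exp z₀)) :=
    tendsto_nhdsWithin_of_tendsto_nhds (Continuous.tendsto (by fun_prop) _)
  have h4 := h1.mul (h3.div (h2.pow 2) (pow_ne_zero 2 (exp_ne_zero _)))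
  rw [zero_mul] at h4
  rw [Asymptotics.isLittleO_iff_tendsto']
  · refine h4.congr' ?_
    filter_upwards [self_mem_nhdsWithin] with z hz'
    have hne : z - z₀ ≠ 0 := sub_ne_zero.mpr hz'
    simp only [slope, Pi.div_apply, vsub_eq_sub, smul_eq_mul, hg0, zero_mul,
      sub_zero, hz, logisticKernel]
    by_cases h : B + exp z = 0
    · simp [h]
    · field_simp
  · filter_upwards [self_mem_nhdsWithin] with z hz' h
    exact absurd (inv_eq_zero.mp h) (sub_ne_zero.mpr hz')

theorem log_add_pi_I_im_mem {B : ℂ} (hB : B ∈ slitPlane) :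
    0 < (log B + Real.pi * I).im ∧ (log B + Real.pi * I).im < 2 * Real.pi := by
  have h1 := neg_pi_lt_arg B
  have h2 := (arg_le_pi B).lt_of_ne (mem_slitPlane_iff_arg.mp hB).1
  simp only [add_im, log_im, mul_im, ofReal_re, I_im, mul_one, ofReal_im, I_re, mul_zero, add_zero]
  constructor <;> linarith

theorem exp_log_add_pi_I {B : ℂ} (hB : B ≠ 0) : B + exp (log B + Real.pi * I) = 0 := by
  rw [exp_add, exp_log hB, exp_pi_mul_I]; ring

theorem integral_logisticKernel_rect {B : ℂ} (hB : B ∈ slitPlane) {g : ℂ → ℂ}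
    (hgd : ∀ z : ℂ, 0 ≤ z.im → DifferentiableAt ℂ g z)
    (hg0 : g (log B + Real.pi * I) = 0) (hg : HasDerivAt g 0 (log B + Real.pi * I)) {R : ℝ}
    (hR : R ≠ (log B + Real.pi * I).re ∧ -R ≠ (log B + Real.pi * I).re) :
    (∫ t in -R..R, g t * logisticKernel B t)
      - (∫ t in -R..R, g (t + 2 * Real.pi * I) * logisticKernel B t)
      + I * (∫ y in 0..2 * Real.pi, g (R + y * I) * logisticKernel B (R + y * I))
      - I * (∫ y in 0..2 * Real.pi, g (-R + y * I) * logisticKernel B (-R + y * I)) = 0 := by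
  set z₀ := log B + Real.pi * I with hz₀
  have hB0 := slitPlane_ne_zero hB
  have him := log_add_pi_I_im_mem hB
  rw [← hz₀] at him
  obtain ⟨him0, him1⟩ := him
  set G : ℂ → ℂ := fun z => g z * logisticKernel B z with hG
  -- F fills in the removable singularity, so Cauchy's theorem applies to the whole rectangle with
  -- no residue.
  set F := Function.update G z₀ (limUnder (𝓝[≠] z₀) G) with hF
  have hFG : ∀ z, z ≠ z₀ → F z = G z := fun z hz => Function.update_of_ne hz _ _
  have hGd : ∀ z : ℂ, 0 ≤ z.im → z.im ≤ 2 * Real.pi → z ≠ z₀ → DifferentiableAt ℂ G z := by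
    intro z h0 h1 hz
    have hne : B + exp z ≠ 0 := fun h => hz (eq_log_add_pi_of_add_exp_eq_zero hB h0 h1 h)
    refine (hgd z h0).mul ?_
    unfold logisticKernel
    exact DifferentiableAt.div (by fun_prop) (by fun_prop) (pow_ne_zero 2 hne)
  have hFd : DifferentiableOn ℂ F (uIcc (-R) R ×ℂ uIcc 0 (2 * Real.pi)) := by
    intro z hz
    have hz2 := hz.2
    rw [mem_preimage, uIcc_of_le (by positivity)] at hz2
    by_cases h : z = z₀
    · have hopen : IsOpen {z : ℂ | 0 < z.im ∧ z.im < 2 * Real.pi} :=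
        (isOpen_lt continuous_const continuous_im).inter (isOpen_lt continuous_im continuous_const)
      have hmem : {z : ℂ | 0 < z.im ∧ z.im < 2 * Real.pi} ∈ 𝓝 z₀ := hopen.mem_nhds ⟨him0, him1⟩
      have := differentiableOn_update_limUnder_of_isLittleO hmem (f := G)
        (fun w hw => (hGd w hw.1.1.le hw.1.2.le hw.2).differentiableWithinAt)
        (logisticKernel_isLittleO hB0 (exp_log_add_pi_I hB0) hg0 hg)
      rw [h]
      exact (this.differentiableAt hmem).differentiableWithinAt
    · refine ((hGd z hz2.1 hz2.2 h).congr_of_eventuallyEq ?_).differentiableWithinAt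
      filter_upwards [isOpen_ne.mem_nhds h] with w hw using hFG w hw
  have key := integral_boundary_rect_eq_zero_of_differentiableOn F (-R : ℂ)
    (R + (2 * Real.pi : ℝ) * I) (by simpa using hFd)
  simp only [neg_re, ofReal_re, neg_im, ofReal_im, neg_zero, add_re, mul_re, I_re, mul_zero, I_im,
    mul_one, sub_zero, add_zero, add_im, mul_im, zero_add, ofReal_zero, zero_mul, smul_eq_mul] at key
  have e1 : ∀ t : ℝ, F t = g t * logisticKernel B t := fun t => hFG _ fun h => by
    rw [← h] at him0; simp at him0
  have e2 : ∀ t : ℝ, F (t + (2 * Real.pi : ℝ) * I)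
      = g (t + 2 * Real.pi * I) * logisticKernel B t := fun t => by
    rw [hFG _ fun h => by rw [← h] at him1; simp at him1]
    simp only [hG, ofReal_mul, ofReal_ofNat, logisticKernel_add_two_pi_I]
  have e3 : ∀ y : ℝ, F (R + y * I) = G (R + y * I) := fun y => hFG _ fun h => by
    rw [← h] at hR; simp at hR
  have e4 : ∀ y : ℝ, F ((-R : ℝ) + y * I) = G (-R + y * I) := fun y => by
    rw [hFG _ fun h => by rw [← h] at hR; simp at hR]; simp
  simp only [e1, e2, e3, e4] at key
  exact key

theorem tendsto_vertical_integral {G : ℂ → ℂ} {C R₀ : ℝ}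
    (hG : ∀ z : ℂ, R₀ ≤ |z.re| → 0 ≤ z.im → z.im ≤ 2 * Real.pi →
      ‖G z‖ ≤ C * Real.exp (-(1 / 2) * |z.re|)) {x : ℝ → ℝ} (hx : ∀ R, 0 ≤ R → |x R| = R) :
    Tendsto (fun R : ℝ => ∫ y in 0..2 * Real.pi, G (x R + y * I)) atTop (𝓝 0) := by
  have hlim : Tendsto (fun R : ℝ => C * Real.exp (-(1 / 2) * R) * |2 * Real.pi - 0|) atTop
      (𝓝 (C * 0 * |2 * Real.pi - 0|)) := by
    refine Tendsto.mul_const _ (Tendsto.const_mul _ ?_)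
    exact Real.tendsto_exp_atBot.comp (tendsto_id.const_mul_atTop_of_neg (by norm_num))
  rw [mul_zero, zero_mul] at hlim
  refine squeeze_zero_norm' ?_ hlim
  filter_upwards [eventually_ge_atTop (max 0 R₀)] with R hR
  have hR0 : 0 ≤ R := (le_max_left _ _).trans hR
  refine intervalIntegral.norm_integral_le_of_norm_le_const fun y hy => ?_
  rw [uIoc_of_le (by positivity)] at hy
  have h := hG (x R + y * I) (by simpa [hx R hR0] using (le_max_right _ _).trans hR)
    (by simpa using hy.1.le) (by simpa using hy.2)
  simpa [hx R hR0] using h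

/-- The rectangle is stretched to infinity; on the vertical sides the decay e^{-|Re z|} of the
kernel beats the growth e^{|Re z|/2} of g. -/
theorem integral_logisticKernel_shift {B : ℂ} (hB : B ∈ slitPlane) {g : ℂ → ℂ}
    (hgd : ∀ z : ℂ, 0 ≤ z.im → DifferentiableAt ℂ g z)
    (hg0 : g (log B + Real.pi * I) = 0) (hg : HasDerivAt g 0 (log B + Real.pi * I)) {C : ℝ}
    (hC : 0 ≤ C) (hgC : ∀ z : ℂ, 0 ≤ z.im → z.im ≤ 2 * Real.pi →
      ‖g z‖ ≤ C * Real.exp (1 / 2 * |z.re|))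
    (hint : Integrable fun t : ℝ => (g t - g (t + 2 * Real.pi * I)) * logisticKernel B t) :
    ∫ t : ℝ, (g t - g (t + 2 * Real.pi * I)) * logisticKernel B t = 0 := by
  obtain ⟨D, R₀, hD0, hD⟩ := exists_norm_logisticKernel_le (slitPlane_ne_zero hB)
  have hbound : ∀ z : ℂ, R₀ ≤ |z.re| → 0 ≤ z.im → z.im ≤ 2 * Real.pi →
      ‖g z * logisticKernel B z‖ ≤ C * D * Real.exp (-(1 / 2) * |z.re|) := by
    intro z h0 h1 h2
    rw [norm_mul]
    calc _ ≤ (C * Real.exp (1 / 2 * |z.re|)) * (D * Real.exp (-|z.re|)) := by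
          gcongr
          exacts [hgC z h1 h2, hD z h0]
      _ = C * D * (Real.exp (1 / 2 * |z.re|) * Real.exp (-|z.re|)) := by ring
      _ = _ := by rw [← Real.exp_add]; ring_nf
  have hr := tendsto_vertical_integral hbound (x := id) fun R hR => abs_of_nonneg hR
  have hl := tendsto_vertical_integral hbound (x := fun R => -R)
    fun R hR => by rw [abs_neg, abs_of_nonneg hR]
  have hlim := intervalIntegral_tendsto_integral hint tendsto_neg_atTop_atBot tendsto_id
  refine tendsto_nhds_unique hlim ?_
  have h0 := (hl.const_mul I).sub (hr.const_mul I)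
  simp only [mul_zero, sub_zero] at h0
  refine h0.congr' ?_
  filter_upwards [eventually_gt_atTop |(log B + Real.pi * I).re|] with R hR
  have h1 : R ≠ (log B + Real.pi * I).re ∧ -R ≠ (log B + Real.pi * I).re := by
    obtain ⟨h2, h3⟩ := abs_lt.mp hR
    exact ⟨h3.ne', by linarith [h2] |> fun h : -R < _ => h.ne⟩
  have hrect := integral_logisticKernel_rect hB hgd hg0 hg h1
  have hk := continuous_logisticKernel_ofReal hB
  have hc1 : Continuous fun t : ℝ => g t * logisticKernel B t := by
    refine Continuous.mul (continuous_iff_continuousAt.mpr fun t => ?_) hk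
    exact (hgd t (by simp)).continuousAt.comp (f := fun t : ℝ => (t : ℂ)) (by fun_prop)
  have hc2 : Continuous fun t : ℝ => g (t + 2 * Real.pi * I) * logisticKernel B t := by
    refine Continuous.mul (continuous_iff_continuousAt.mpr fun t => ?_) hk
    exact (hgd (t + 2 * Real.pi * I) (by simp [Real.pi_pos.le])).continuousAt.comp
      (f := fun t : ℝ => (t + 2 * Real.pi * I : ℂ)) (by fun_prop)
  simp only [sub_mul, id_eq]
  rw [intervalIntegral.integral_sub (hc1.intervalIntegrable _ _) (hc2.intervalIntegrable _ _)]
  simp only [ofReal_neg]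
  linear_combination -hrect

/-! ### Moments of the kernel and the Hurwitz series -/

/-- The `p`-th moment `∫ (α + t) ^ p` of the logistic kernel. -/
noncomputable def logisticMoment (p α B : ℂ) : ℂ := ∫ t : ℝ, (α + t) ^ p * logisticKernel B t

/-- This is the residue at the double pole z₀ = log B + πi, obtained without a residue theorem. The
first-order Taylor polynomial of (α + z)^p at z₀ is subtracted, leaving a double zero. In g(t) - g(t
+ 2πi) the constant term cancels, and the linear term contributes 2πi d times the kernel, whose
integral is 1. As Im α > 0, α + z avoids the cut for all Im z ≥ 0. -/
theorem logisticMoment_sub {α B : ℂ} (hα : 0 < α.im) (hB : B ∈ slitPlane) (p : ℂ) :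
    logisticMoment p α B - logisticMoment p (α + 2 * Real.pi * I) B
      = -(2 * Real.pi * I) * (p * (α + (log B + Real.pi * I)) ^ (p - 1)) := by
  set z₀ := log B + Real.pi * I with hz₀
  set d := p * (α + z₀) ^ (p - 1) with hd
  have him := log_add_pi_I_im_mem hB
  rw [← hz₀] at him
  have hα2 : 0 < (α + 2 * Real.pi * I).im := by simp; positivity
  set g : ℂ → ℂ := fun z => (α + z) ^ p - (α + z₀) ^ p - d * (z - z₀) with hg
  have hderiv : ∀ z : ℂ, 0 ≤ z.im → HasDerivAt g (p * (α + z) ^ (p - 1) - d) z := by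
    intro z hz
    have h1 := ((hasDerivAt_id z).const_add α).cpow_const (c := p)
      (add_mem_slitPlane_of_im_pos (by simp; linarith))
    have h2 := (h1.sub_const ((α + z₀) ^ p)).sub (((hasDerivAt_id z).sub_const z₀).const_mul d)
    exact h2.congr_deriv (by simp)
  obtain ⟨C, hC0, hC⟩ := exists_norm_add_cpow_le hα p (ε := 1 / 2) (by norm_num) (2 * Real.pi)
    (by positivity)
  have hgC : ∀ z : ℂ, 0 ≤ z.im → z.im ≤ 2 * Real.pi →
      ‖g z‖ ≤ (C + ‖(α + z₀) ^ p‖ + ‖d‖ * (2 + 2 * Real.pi + ‖z₀‖)) *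
        Real.exp (1 / 2 * |z.re|) := by
    intro z h0 h1
    have hz : ‖z‖ ≤ |z.re| + 2 * Real.pi := by
      have := norm_le_abs_re_add_abs_im z
      rw [abs_of_nonneg h0] at this
      linarith
    set E := Real.exp (1 / 2 * |z.re|) with hE
    have hE1 : 1 ≤ E := Real.one_le_exp (by positivity)
    have hE2 : |z.re| ≤ 2 * E := by
      have := Real.add_one_le_exp (1 / 2 * |z.re|); linarith
    have hsub : ‖z - z₀‖ ≤ (2 + 2 * Real.pi + ‖z₀‖) * E := by
      have := norm_sub_le z z₀
      nlinarith [norm_nonneg z₀, Real.pi_pos]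
    calc ‖g z‖ ≤ ‖(α + z) ^ p‖ + ‖(α + z₀) ^ p‖ + ‖d * (z - z₀)‖ :=
          (norm_sub_le _ _).trans (by gcongr; exact norm_sub_le _ _)
      _ ≤ C * E + ‖(α + z₀) ^ p‖ * E + ‖d‖ * ((2 + 2 * Real.pi + ‖z₀‖) * E) := by
          rw [norm_mul]
          gcongr
          · exact hC z h0 h1
          · exact le_mul_of_one_le_right (norm_nonneg _) hE1
      _ = _ := by ring
  have heq : ∀ t : ℝ, (g t - g (t + 2 * Real.pi * I)) * logisticKernel B t
      = (α + t) ^ p * logisticKernel B t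
        - (α + 2 * Real.pi * I + t) ^ p * logisticKernel B t
        + 2 * Real.pi * I * d * logisticKernel B t := by
    intro t
    simp only [hg]
    rw [show α + (t + 2 * Real.pi * I) = α + 2 * Real.pi * I + t by ring]
    ring
  have i1 := integrable_add_cpow_mul_logisticKernel hα hB p
  have i2 := integrable_add_cpow_mul_logisticKernel hα2 hB p
  have i3 := (integrable_logisticKernel hB).const_mul (2 * Real.pi * I * d)
  have key := integral_logisticKernel_shift hB (g := g)
    (fun z hz => (hderiv z hz).differentiableAt) (by simp [hg, ← hz₀])
    (by simpa [← hz₀, hd] using hderiv z₀ him.1.le) (by positivity) hgC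
    (by simp only [heq]; exact (i1.sub i2).add i3)
  simp only [heq] at key
  have i12 : Integrable fun t : ℝ => (α + t) ^ p * logisticKernel B t
      - (α + 2 * Real.pi * I + t) ^ p * logisticKernel B t := i1.sub i2
  rw [integral_add i12 i3, integral_sub i1 i2, integral_const_mul,
    integral_logisticKernel hB] at key
  unfold logisticMoment
  linear_combination key

theorem logisticMoment_eq_sum {α B : ℂ} (hα : 0 < α.im) (hB : B ∈ slitPlane) (p : ℂ) (N : ℕ) :
    logisticMoment p α B = -(2 * Real.pi * I) * p *
        ∑ n ∈ Finset.range N, (α + log B + Real.pi * I + 2 * Real.pi * I * n) ^ (p - 1)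
      + logisticMoment p (α + 2 * Real.pi * I * N) B := by
  induction N with
  | zero => simp
  | succ N ih =>
    have h := logisticMoment_sub (α := α + 2 * Real.pi * I * N)
      (by simp; positivity) hB p
    rw [ih, Finset.sum_range_succ]
    rw [show α + 2 * Real.pi * I * N + (log B + Real.pi * I)
      = α + log B + Real.pi * I + 2 * Real.pi * I * N by ring] at h
    push_cast
    rw [show α + 2 * Real.pi * I * (N + 1) = α + 2 * Real.pi * I * N + 2 * Real.pi * I by ring]
    linear_combination h

/-- ‖α + 2πiN + t‖ is at least its imaginary part, which tends to infinity uniformly in t. -/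
theorem tendsto_logisticMoment_add {α B : ℂ} (hα : 0 < α.im) (hB : B ∈ slitPlane) {p : ℂ}
    (hp : p.re < 0) :
    Tendsto (fun N : ℕ => logisticMoment p (α + 2 * Real.pi * I * N) B) atTop (𝓝 0) := by
  have hint := integrable_logisticKernel hB
  have hlim : Tendsto (fun N : ℕ => (α.im + 2 * Real.pi * N) ^ p.re *
      (Real.exp (Real.pi * |p.im|) * ∫ t : ℝ, ‖logisticKernel B t‖)) atTop (𝓝 (0 *
      (Real.exp (Real.pi * |p.im|) * ∫ t : ℝ, ‖logisticKernel B t‖))) := by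
    refine Tendsto.mul_const _ ?_
    have h1 : Tendsto (fun N : ℕ => α.im + 2 * Real.pi * N) atTop atTop :=
      tendsto_atTop_add_const_left _ _
        (tendsto_natCast_atTop_atTop.const_mul_atTop (by positivity))
    have h2 := (tendsto_rpow_neg_atTop (neg_pos.mpr hp)).comp h1
    simpa [Function.comp_def] using h2
  rw [zero_mul] at hlim
  refine squeeze_zero_norm (fun N => ?_) hlim
  rw [← mul_assoc, ← integral_const_mul]
  refine norm_integral_le_of_norm_le (hint.norm.const_mul _) (ae_of_all _ fun t => ?_)
  rw [norm_mul]
  gcongr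
  refine (norm_cpow_le_rpow_mul_exp _ _).trans ?_
  refine mul_le_mul_of_nonneg_right ?_ (Real.exp_pos _).le
  refine Real.rpow_le_rpow_of_nonpos (by positivity) ?_ hp.le
  calc _ = (α + 2 * Real.pi * I * N + t).im := by simp
    _ ≤ _ := (le_abs_self _).trans (abs_im_le_norm _)

/-- arg(2πi) = π/2 and |arg z| < π/2, so the arguments add up to a value in (0, π) and no branch is
crossed. -/
theorem two_pi_I_mul_cpow {z : ℂ} (hz : 0 < z.re) (w : ℂ) :
    (2 * Real.pi * I * z) ^ w = (2 * Real.pi * I) ^ w * z ^ w := by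
  have hz0 : z ≠ 0 := fun h => by simp [h] at hz
  have h2 : (2 * Real.pi * I : ℂ) ≠ 0 := by simp [Real.pi_ne_zero]
  have harg : arg (2 * Real.pi * I : ℂ) = Real.pi / 2 := by
    rw [show (2 * Real.pi * I : ℂ) = ((2 * Real.pi : ℝ) : ℂ) * I by push_cast; ring,
      arg_real_mul _ (by positivity), arg_I]
  have hz' := abs_lt.mp (abs_arg_lt_pi_div_two_iff.mpr (.inl hz))
  rw [cpow_def_of_ne_zero (mul_ne_zero h2 hz0), cpow_def_of_ne_zero h2, cpow_def_of_ne_zero hz0,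
    log_mul h2 hz0 (by rw [harg]; constructor <;> linarith [hz'.1, hz'.2, Real.pi_pos]),
    add_mul, exp_add]

theorem logisticMoment_eq_tsum {α B : ℂ} (hα : 0 < α.im) (hB : B ∈ slitPlane) {p : ℂ}
    (hp : p.re < 0) :
    logisticMoment p α B = -p * (2 * Real.pi * I) ^ p *
      ∑' n : ℕ, 1 / (n + (α + log B + Real.pi * I) / (2 * Real.pi * I)) ^ (1 - p) := by
  set q := (α + log B + Real.pi * I) / (2 * Real.pi * I) with hq
  have h2 : (2 * Real.pi * I : ℂ) ≠ 0 := by simp [Real.pi_ne_zero]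
  have hqmul : 2 * Real.pi * I * q = α + log B + Real.pi * I := by rw [hq]; field_simp
  have hqre : 0 < q.re := by
    have h1 := congrArg im hqmul
    have h3 := (log_add_pi_I_im_mem hB).1
    simp only [add_im] at h1 h3
    simp at h1 h3
    have : 0 < 2 * Real.pi * q.re := by linarith
    exact pos_of_mul_pos_right this (by positivity)
  have hs := (summable_one_div_natCast_add_cpow q (s := 1 - p) (by simp; linarith)).hasSum
  have hl := ((hs.tendsto_sum_nat.const_mul (-p * (2 * Real.pi * I) ^ p)).add
    (tendsto_logisticMoment_add hα hB hp))
  rw [add_zero] at hl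
  refine tendsto_nhds_unique ?_ hl
  refine tendsto_const_nhds.congr fun N => ?_
  rw [logisticMoment_eq_sum hα hB p N, Finset.mul_sum, Finset.mul_sum]
  congr 1
  refine Finset.sum_congr rfl fun n _ => ?_
  rw [← hqmul, ← mul_add, two_pi_I_mul_cpow (by simp; positivity), cpow_sub _ _ h2, cpow_one,
    one_div, ← cpow_neg, neg_sub, add_comm q]
  field_simp

/-! ### Analytic continuation through the exponent of the moment -/

theorem exists_norm_log_le_exp {η A ε : ℝ} (hη : 0 < η) (hA : 0 ≤ A) (hε : 0 < ε) :
    ∃ C, 0 ≤ C ∧ ∀ (z : ℂ) (t : ℝ), η ≤ ‖z‖ → ‖z‖ ≤ A + |t| →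
      ‖log z‖ ≤ C * Real.exp (ε * |t|) := by
  obtain ⟨C, hC0, hC⟩ := exists_add_abs_rpow_le_exp (A := A + 1 / η + Real.pi) (M := 1)
    (by positivity) zero_le_one hε
  refine ⟨C, hC0, fun z t h1 h2 => le_trans ?_ (hC t)⟩
  have hz : 0 < ‖z‖ := hη.trans_le h1
  have h3 := norm_le_abs_re_add_abs_im (log z)
  rw [log_re, log_im] at h3
  have h4 := abs_arg_le_pi z
  have h5 : |Real.log ‖z‖| ≤ A + |t| + 1 / η := by
    have h6 : 0 < 1 / η := by positivity
    rw [abs_le]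
    constructor
    · have h7 := Real.log_le_sub_one_of_pos (inv_pos.mpr hz)
      rw [Real.log_inv] at h7
      have h8 : ‖z‖⁻¹ ≤ 1 / η := by rw [one_div]; gcongr
      linarith [abs_nonneg t]
    · linarith [Real.log_le_sub_one_of_pos hz]
  rw [Real.rpow_one]
  linarith

theorem differentiable_logisticMoment {α B : ℂ} (hα : 0 < α.im) (hB : B ∈ slitPlane) :
    Differentiable ℂ fun p => logisticMoment p α B := by
  intro p₀
  have hslit : ∀ t : ℝ, α + t ∈ slitPlane := fun t => .inr (by simpa using hα.ne')
  have hlow : ∀ t : ℝ, α.im ≤ ‖α + t‖ := fun t => by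
    simpa using (le_abs_self _).trans (abs_im_le_norm (α + t))
  have hup : ∀ t : ℝ, ‖α + t‖ ≤ ‖α‖ + |t| := fun t => by simpa using norm_add_le α t
  -- The p-derivative carries a power and a logarithm; rate 1/4 for each leaves decay e^{-|t|/2}
  -- against the kernel.
  obtain ⟨C, hC0, hC⟩ := exists_norm_cpow_le_exp hα (norm_nonneg α) (M := ‖p₀‖ + 1)
    (by positivity) (ε := 1 / 4) (by norm_num)
  obtain ⟨E, hE0, hE⟩ := exists_norm_log_le_exp hα (norm_nonneg α) (ε := 1 / 4) (by norm_num)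
  obtain ⟨D, hD0, hD⟩ := exists_norm_logisticKernel_ofReal_le hB
  have hk := continuous_logisticKernel_ofReal hB
  have hlog : Continuous fun t : ℝ => log (α + t) := Continuous.clog (by fun_prop) hslit
  refine (hasDerivAt_integral_of_dominated_loc_of_deriv_le (μ := volume)
    (F := fun p (t : ℝ) => (α + t) ^ p * logisticKernel B t)
    (F' := fun p (t : ℝ) => (α + t) ^ p * log (α + t) * logisticKernel B t)
    (bound := fun t => C * E * D * Real.exp (-(1 / 2) * |t|))
    (Metric.ball_mem_nhds p₀ one_pos)
    (.of_forall fun p =>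
      ((continuous_add_ofReal_cpow hα p).mul hk).aestronglyMeasurable)
    (integrable_add_cpow_mul_logisticKernel hα hB p₀)
    (((continuous_add_ofReal_cpow hα p₀).mul hlog).mul hk).aestronglyMeasurable
    (ae_of_all _ fun t p hp => ?_)
    ((integrable_exp_neg_mul_abs (by norm_num)).const_mul _)
    (ae_of_all _ fun t p _ => ?_)).2.differentiableAt
  · have hp' : ‖p‖ ≤ ‖p₀‖ + 1 := by
      have := norm_le_norm_add_norm_sub' p p₀
      rw [mem_ball_iff_norm] at hp
      linarith
    rw [norm_mul, norm_mul]
    calc _ ≤ (C * Real.exp (1 / 4 * |t|)) * (E * Real.exp (1 / 4 * |t|)) *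
          (D * Real.exp (-|t|)) := by
          gcongr
          exacts [hC _ _ _ (hlow t) (hup t) hp', hE _ _ (hlow t) (hup t), hD t]
      _ = C * E * D * (Real.exp (1 / 4 * |t|) * Real.exp (1 / 4 * |t|) * Real.exp (-|t|)) := by
          ring
      _ = _ := by rw [← Real.exp_add, ← Real.exp_add]; ring_nf
  · have h := (hasDerivAt_id p).const_cpow (c := α + t) (.inl (slitPlane_ne_zero (hslit t)))
    simpa using h.mul_const (logisticKernel B t)

/-- For Re s > 1 the exponent 1 - s has negative real part, where the moment is the series. The
moment is entire in its exponent, so dividing by 1 - s loses holomorphy at s = 1 only. -/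
theorem isHurwitzZeta_logisticMoment {α B : ℂ} (hα : 0 < α.im) (hB : B ∈ slitPlane) :
    IsHurwitzZeta ((α + log B + Real.pi * I) / (2 * Real.pi * I)) fun s =>
      -logisticMoment (1 - s) α B / ((1 - s) * (2 * Real.pi * I) ^ (1 - s)) := by
  have h2 : (2 * Real.pi * I : ℂ) ≠ 0 := by simp [Real.pi_ne_zero]
  constructor
  · intro s hs
    have hs1 : 1 - s ≠ 0 := sub_ne_zero.mpr (Ne.symm hs)
    have hsub : DifferentiableAt ℂ (fun s : ℂ => 1 - s) s := by fun_prop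
    have hne : (1 - s) * (2 * Real.pi * I) ^ (1 - s) ≠ 0 :=
      mul_ne_zero hs1 (by simp [cpow_eq_zero_iff, h2])
    have hn : DifferentiableAt ℂ (fun s => -logisticMoment (1 - s) α B) s :=
      ((differentiable_logisticMoment hα hB (1 - s)).comp s hsub).neg
    have hd : DifferentiableAt ℂ (fun s : ℂ => (1 - s) * (2 * Real.pi * I) ^ (1 - s)) s :=
      hsub.mul (hsub.const_cpow (.inl h2))
    exact (hn.fun_div hd hne).differentiableWithinAt
  · intro s hs
    have hs1 : 1 - s ≠ 0 := fun h => by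
      rw [← sub_eq_zero.mp h] at hs; simp at hs
    have hp : (2 * Real.pi * I) ^ (1 - s) ≠ 0 := by simp [cpow_eq_zero_iff, h2]
    simp only [logisticMoment_eq_tsum hα hB (p := 1 - s) (by simpa using hs), sub_sub_cancel]
    field_simp

theorem mul_hurwitzZetaC_eq_neg_logisticMoment {α B : ℂ} (hα : 0 < α.im) (hB : B ∈ slitPlane)
    {p : ℂ} (hp : p ≠ 0) :
    p * (2 * Real.pi * I) ^ p *
        hurwitzZetaC (1 - p) ((α + log B + Real.pi * I) / (2 * Real.pi * I))
      = -logisticMoment p α B := by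
  have h2 : (2 * Real.pi * I : ℂ) ≠ 0 := by simp [Real.pi_ne_zero]
  have h3 : (2 * Real.pi * I) ^ p ≠ 0 := by simp [cpow_eq_zero_iff, h2]
  rw [(isHurwitzZeta_logisticMoment hα hB).hurwitzZetaC_eq (by simpa using hp), sub_sub_cancel]
  field_simp

/-- With B = 1, the choice α = 2πiq - πi makes the second zeta argument equal to q; Im α > 0 then
amounts to Re q > 1/2. -/
theorem add_pi_I_div_two_pi_I (q : ℂ) :
    (2 * Real.pi * I * q - Real.pi * I + log 1 + Real.pi * I) / (2 * Real.pi * I) = q := by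
  have h2 : (2 * Real.pi * I : ℂ) ≠ 0 := by simp [Real.pi_ne_zero]
  rw [log_one, div_eq_iff h2]
  ring

theorem two_pi_I_mul_sub_im_pos {q : ℂ} (hq : 1 / 2 < q.re) :
    0 < (2 * Real.pi * I * q - Real.pi * I).im := by
  have : (2 * Real.pi * I * q - Real.pi * I).im = Real.pi * (2 * q.re - 1) := by
    simp; ring
  rw [this]
  exact mul_pos Real.pi_pos (by linarith)

theorem exists_isHurwitzZeta (q : ℂ) : ∃ Z, IsHurwitzZeta q Z := by
  refine exists_isHurwitzZeta_of_re_large (fun q hq => ?_) q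
  have h := isHurwitzZeta_logisticMoment (two_pi_I_mul_sub_im_pos hq) one_mem_slitPlane
  rw [add_pi_I_div_two_pi_I] at h
  exact ⟨_, h⟩

theorem hurwitzZetaC_eq_of_re_gt {q p : ℂ} (hq : 1 / 2 < q.re) (hp : p ≠ 0) :
    hurwitzZetaC (1 - p) q = -(p * (2 * Real.pi * I) ^ p)⁻¹ *
      logisticMoment p (2 * Real.pi * I * q - Real.pi * I) 1 := by
  have h2 : (2 * Real.pi * I : ℂ) ≠ 0 := by simp [Real.pi_ne_zero]
  have h3 : (2 * Real.pi * I) ^ p ≠ 0 := by simp [cpow_eq_zero_iff, h2]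
  have h := mul_hurwitzZetaC_eq_neg_logisticMoment (two_pi_I_mul_sub_im_pos hq)
    one_mem_slitPlane hp
  rw [add_pi_I_div_two_pi_I] at h
  rw [neg_mul, ← mul_neg, ← h]
  field_simp

/-! ### Dependence of ζ(s, q) on q: continuity, and polynomials at negative integers -/

theorem continuousAt_logisticMoment {α₀ B : ℂ} (hα : 0 < α₀.im) (hB : B ∈ slitPlane) (p : ℂ) :
    ContinuousAt (fun α => logisticMoment p α B) α₀ := by
  have hη : 0 < α₀.im / 2 := by positivity
  obtain ⟨C, hC0, hC⟩ := exists_norm_cpow_le_exp hη (A := ‖α₀‖ + 1) (by positivity)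
    (norm_nonneg p) (ε := 1 / 2) (by norm_num)
  obtain ⟨D, hD0, hD⟩ := exists_norm_logisticKernel_ofReal_le hB
  have hk := continuous_logisticKernel_ofReal hB
  have hev : ∀ᶠ α in 𝓝 α₀, α₀.im / 2 < α.im ∧ ‖α‖ < ‖α₀‖ + 1 :=
    ((isOpen_lt continuous_const continuous_im).inter
      (isOpen_lt continuous_norm continuous_const)).mem_nhds
        ⟨show α₀.im / 2 < α₀.im by linarith, show ‖α₀‖ < ‖α₀‖ + 1 by linarith⟩
  refine continuousAt_of_dominated (bound := fun t => C * D * Real.exp (-(1 / 2) * |t|)) ?_ ?_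
    ((integrable_exp_neg_mul_abs (by norm_num)).const_mul _) (ae_of_all _ fun t => ?_)
  · filter_upwards [hev] with α h
    exact ((continuous_add_ofReal_cpow (hη.trans h.1) p).mul hk).aestronglyMeasurable
  · filter_upwards [hev] with α h
    refine ae_of_all _ fun t => ?_
    rw [norm_mul]
    calc _ ≤ (C * Real.exp (1 / 2 * |t|)) * (D * Real.exp (-|t|)) := by
          gcongr
          · refine hC _ _ _ ?_ ?_ le_rfl
            · have h1 := (le_abs_self _).trans (abs_im_le_norm (α + t))
              simp only [add_im, ofReal_im, add_zero] at h1
              linarith [h.1]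
            · have h1 := norm_add_le α t
              rw [norm_real, Real.norm_eq_abs] at h1
              linarith [h.2]
          · exact hD t
      _ = C * D * (Real.exp (1 / 2 * |t|) * Real.exp (-|t|)) := by ring
      _ = _ := by rw [← Real.exp_add]; ring_nf
  · refine ContinuousAt.mul (ContinuousAt.cpow (by fun_prop) continuousAt_const ?_)
      continuousAt_const
    exact .inr (by simpa using hα.ne')

/-- One shift reduces Re q ≥ 0 to Re q > 1/2, where the moment is continuous. The split-off power
q^(-s) meets the cut only at q = 0, and is continuous there when Re s < 0. -/
theorem continuousAt_hurwitzZetaC {s q : ℂ} (hs1 : s ≠ 1) (hs0 : s ≠ 0) (hq : 0 ≤ q.re)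
    (h : q ≠ 0 ∨ s.re < 0) : ContinuousAt (hurwitzZetaC s) q := by
  have key : ∀ q : ℂ, 1 / 2 < q.re → ContinuousAt (hurwitzZetaC s) q := by
    intro q hq
    have hp : 1 - s ≠ 0 := sub_ne_zero.mpr hs1.symm
    have h1 : ContinuousAt (fun q => -((1 - s) * (2 * Real.pi * I) ^ (1 - s))⁻¹ *
        logisticMoment (1 - s) (2 * Real.pi * I * q - Real.pi * I) 1) q :=
      continuousAt_const.mul ((continuousAt_logisticMoment (two_pi_I_mul_sub_im_pos hq)
        one_mem_slitPlane (1 - s)).comp (f := fun q : ℂ => 2 * Real.pi * I * q - Real.pi * I)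
          (by fun_prop))
    refine h1.congr ?_
    filter_upwards [(isOpen_lt continuous_const continuous_re).mem_nhds hq] with w hw
    rw [← hurwitzZetaC_eq_of_re_gt hw hp, sub_sub_cancel]
  have heq : hurwitzZetaC s = fun q => q ^ (-s) + hurwitzZetaC s (q + 1) :=
    funext fun q => hurwitzZetaC_eq_add_one exists_isHurwitzZeta hs1 hs0 q
  rw [heq]
  refine ContinuousAt.add ?_ ((key (q + 1) (by simp; linarith)).comp
    (f := fun q : ℂ => q + 1) (by fun_prop))
  by_cases hs : s.re < 0
  · exact continuousAt_cpow_const_of_re_pos (.inl hq) (by simpa using hs)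
  · refine continuousAt_cpow_const ?_
    rcases hq.eq_or_lt with h0 | h0
    · exact .inr fun h1 => h.elim (fun h => h (Complex.ext h0.symm h1)) hs
    · exact .inl h0

theorem exists_polynomial_integral_add_pow {φ : ℝ → ℂ}
    (h : ∀ j : ℕ, Integrable fun t : ℝ => (t : ℂ) ^ j * φ t) (n : ℕ) :
    ∃ P : Polynomial ℂ, ∀ α : ℂ, ∫ t : ℝ, (α + t) ^ n * φ t = P.eval α := by
  refine ⟨∑ j ∈ Finset.range (n + 1), Polynomial.C ((n.choose j : ℂ) *
    ∫ t : ℝ, (t : ℂ) ^ (n - j) * φ t) * Polynomial.X ^ j, fun α => ?_⟩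
  simp only [Polynomial.eval_finsetSum, Polynomial.eval_mul, Polynomial.eval_C,
    Polynomial.eval_pow, Polynomial.eval_X, add_pow, Finset.sum_mul]
  have heq : ∀ (j : ℕ) (t : ℝ), α ^ j * (t : ℂ) ^ (n - j) * (n.choose j) * φ t
      = (α ^ j * n.choose j) * ((t : ℂ) ^ (n - j) * φ t) := fun j t => by ring
  simp only [heq]
  rw [integral_finsetSum _ fun j _ => (h (n - j)).const_mul _]
  refine Finset.sum_congr rfl fun j _ => ?_
  rw [integral_const_mul]
  ring

theorem exists_norm_ofReal_pow_le_exp (j : ℕ) {ε : ℝ} (hε : 0 < ε) :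
    ∃ C, 0 ≤ C ∧ ∀ t : ℝ, ‖(t : ℂ) ^ j‖ ≤ C * Real.exp (ε * |t|) := by
  obtain ⟨C, hC0, hC⟩ := exists_add_abs_rpow_le_exp (A := 0) le_rfl (Nat.cast_nonneg j) hε
  exact ⟨C, hC0, fun t => by simpa using hC t⟩

theorem infinite_setOf_re_gt (x : ℝ) : {q : ℂ | x < q.re}.Infinite := by
  have h : (ofReal '' Ioi x).Infinite := (Ioi_infinite x).image ofReal_injective.injOn
  refine h.mono ?_
  rintro _ ⟨y, hy, rfl⟩
  exact hy

/-- For Re q > 1/2 the moment has the integer exponent m + 1, so it expands to a polynomial in q.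
That polynomial inherits the shift relation of ζ(-m, ·), which carries the equality to all q. For m
= 0 the relation would fail at q = 0, because 0^0 = 1. -/
theorem exists_polynomial_hurwitzZetaC {m : ℕ} (hm : m ≠ 0) :
    ∃ P : Polynomial ℂ, ∀ q : ℂ, hurwitzZetaC (-m) q = P.eval q := by
  have hint : ∀ j : ℕ, Integrable fun t : ℝ => (t : ℂ) ^ j * logisticKernel 1 t := fun j => by
    obtain ⟨C, -, hC⟩ := exists_norm_ofReal_pow_le_exp j (ε := 1 / 2) (by norm_num)
    obtain ⟨D, -, hD⟩ := exists_norm_logisticKernel_ofReal_le one_mem_slitPlane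
    exact integrable_mul_of_norm_le_exp (Continuous.aestronglyMeasurable (by fun_prop))
      (continuous_logisticKernel_ofReal one_mem_slitPlane).aestronglyMeasurable hC hD
  obtain ⟨Q, hQ⟩ := exists_polynomial_integral_add_pow hint (m + 1)
  set c : ℂ := -((m + 1 : ℂ) * (2 * Real.pi * I) ^ (m + 1 : ℂ))⁻¹ with hc
  set P : Polynomial ℂ := Polynomial.C c *
    Q.comp (Polynomial.C (2 * Real.pi * I) * Polynomial.X - Polynomial.C (Real.pi * I)) with hP
  have hlarge : ∀ q : ℂ, 1 / 2 < q.re → hurwitzZetaC (-m) q = P.eval q := by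
    intro q hq
    have h := hurwitzZetaC_eq_of_re_gt hq (p := m + 1) (by exact_mod_cast m.succ_ne_zero)
    rw [show (1 : ℂ) - (m + 1) = -m by ring] at h
    rw [h, hP]
    simp only [Polynomial.eval_mul, Polynomial.eval_C, Polynomial.eval_comp, Polynomial.eval_sub,
      Polynomial.eval_X, ← hQ, hc, logisticMoment]
    congr 1
    refine integral_congr_ae (ae_of_all _ fun t => ?_)
    simp only
    rw [← cpow_natCast]
    push_cast
    rfl
  have hm1 : (-m : ℂ) ≠ 1 := fun h => by
    have := congrArg re h
    simp at this
    linarith [(Nat.cast_nonneg m : (0 : ℝ) ≤ m)]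
  have hm0 : (-m : ℂ) ≠ 0 := by simpa using hm
  have hstep : ∀ q : ℂ, hurwitzZetaC (-m) q = q ^ m + hurwitzZetaC (-m) (q + 1) := fun q => by
    rw [hurwitzZetaC_eq_add_one exists_isHurwitzZeta hm1 hm0 q, neg_neg, cpow_natCast]
  have hPshift : P = Polynomial.X ^ m + P.comp (Polynomial.X + 1) := by
    refine Polynomial.eq_of_infinite_eval_eq _ _ ((infinite_setOf_re_gt (1 / 2)).mono fun q hq => ?_)
    have hq' : 1 / 2 < q.re := hq
    simp only [mem_ofPred_eq, Polynomial.eval_add, Polynomial.eval_pow, Polynomial.eval_X,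
      Polynomial.eval_comp, Polynomial.eval_one]
    rw [← hlarge q hq', hstep, hlarge (q + 1) (by simp; linarith)]
  have hPeval : ∀ q, P.eval q = q ^ m + P.eval (q + 1) := fun q => by
    simpa using congrArg (Polynomial.eval q) hPshift
  have key : ∀ N : ℕ, ∀ q : ℂ, 1 / 2 - (N : ℝ) < q.re → hurwitzZetaC (-m) q = P.eval q := by
    intro N
    induction N with
    | zero => intro q hq; exact hlarge q (by simpa using hq)
    | succ N ih =>
      intro q hq
      rw [hstep, ih (q + 1) (by push_cast at hq; simp; linarith), hPeval q]
  refine ⟨P, fun q => ?_⟩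
  obtain ⟨N, hN⟩ := exists_nat_gt (1 / 2 - q.re)
  exact key N q (by linarith)

/-! ### The function log R: branch and bounds -/

/-- The argument of the logarithm in the integrand. -/
noncomputable def logRatio (b : ℂ) (x : ℝ) : ℂ := ((x : ℂ) + 1) * (b ^ 2 + x) / (b + x) ^ 2

theorem add_ofReal_ne_zero {b : ℂ} (hb : 0 ≤ b.re) {x : ℝ} (hx : 0 < x) : b + x ≠ 0 := fun h => by
  have := congrArg re h
  simp at this
  linarith

/-- This form shows the decay of log R at 0 and ∞, and exhibits R - 1 as a square. -/
theorem logRatio_sub_one {b : ℂ} (hb : 0 ≤ b.re) {x : ℝ} (hx : 0 < x) :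
    logRatio b x - 1 = x * (1 - b) ^ 2 / (b + x) ^ 2 := by
  have := add_ofReal_ne_zero hb hx
  rw [logRatio]
  field_simp
  ring

theorem sq_add_ofReal_ne_zero {b : ℂ} (hb : 0 < b.re) {x : ℝ} (hx : 0 < x) : b ^ 2 + x ≠ 0 := by
  intro h
  have h1 := congrArg re h
  have h2 := congrArg im h
  simp [sq] at h1 h2
  have h3 : b.im = 0 := by
    have : b.re * b.im = 0 := by linarith
    exact (mul_eq_zero.mp this).resolve_left hb.ne'
  rw [h3] at h1
  nlinarith

theorem logRatio_mem_slitPlane {b : ℂ} (hb : 0 ≤ b.re) {x : ℝ} (hx : 0 < x)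
    (h : b ^ 2 + x ≠ 0) : logRatio b x ∈ slitPlane := by
  have hbx := add_ofReal_ne_zero hb hx
  have hx1 : (x : ℂ) + 1 ≠ 0 := by exact_mod_cast (by positivity : x + 1 ≠ 0)
  by_contra hR
  rw [mem_slitPlane_iff, not_or, not_lt, not_not] at hR
  have hne : logRatio b x ≠ 0 := div_ne_zero (mul_ne_zero hx1 h) (pow_ne_zero 2 hbx)
  have hre : (logRatio b x).re < 0 :=
    lt_of_le_of_ne hR.1 fun h0 => hne (Complex.ext h0 hR.2)
  -- R = 1 + z². If R were negative, z would be iy with y² > 1; taking real and imaginary parts of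
  -- z(b + x) = √x (1 - b) gives y²(Re b + x) = x(1 - Re b), impossible for Re b ≥ 0.
  set z : ℂ := Real.sqrt x * (1 - b) / (b + x) with hz
  have hs2 : Real.sqrt x * Real.sqrt x = x := Real.mul_self_sqrt hx.le
  have hzR : logRatio b x = 1 + z * z := by
    rw [← sub_eq_iff_eq_add', logRatio_sub_one hb hx, hz]
    have : (x : ℂ) = Real.sqrt x * Real.sqrt x := by exact_mod_cast hs2.symm
    field_simp
    rw [sq (Real.sqrt x : ℂ), ← this]
    ring
  have hzb : z * (b + x) = Real.sqrt x * (1 - b) := by rw [hz]; field_simp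
  have hr := congrArg re hzR
  have hi := congrArg im hzR
  simp only [add_re, add_im, mul_re, mul_im, one_re, one_im] at hr hi
  rw [hR.2] at hi
  have hzim : 1 < z.im * z.im := by nlinarith [mul_self_nonneg z.re]
  have hzre : z.re = 0 := by
    have h1 : z.re * z.im = 0 := by linarith
    refine (mul_eq_zero.mp h1).resolve_right fun h2 => ?_
    rw [h2] at hzim
    linarith
  have e1 := congrArg re hzb
  have e2 := congrArg im hzb
  simp [hzre] at e1 e2
  have e3 : z.im * z.im * (b.re + x) = x * (1 - b.re) := by
    calc _ = z.im * (z.im * (b.re + x)) := by ring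
      _ = Real.sqrt x * (-(z.im * b.im)) := by rw [e2]; ring
      _ = Real.sqrt x * Real.sqrt x * (1 - b.re) := by rw [e1]; ring
      _ = _ := by rw [hs2]
  nlinarith [mul_nonneg hx.le hb]

/-- One bound for two regimes: linear vanishing at w = 1, and an arbitrarily weak power singularity
at w = 0. Once ‖w - 1‖ > 1/2, constants such as π are absorbed into ‖w - 1‖. -/
theorem exists_norm_log_le {δ : ℝ} (hδ : 0 < δ) :
    ∃ C, 0 ≤ C ∧ ∀ w : ℂ, ‖log w‖ ≤ C * ‖w - 1‖ * (1 + ‖w‖ ^ (-δ)) := by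
  refine ⟨2 * Real.pi + 3 + 2 / δ, by positivity, fun w => ?_⟩
  have hpos : 0 ≤ ‖w‖ ^ (-δ) := by positivity
  have hδ' : 0 < 2 / δ := by positivity
  have hpi := Real.pi_pos
  have hn := norm_nonneg (w - 1)
  by_cases h : ‖w - 1‖ ≤ 1 / 2
  · have h1 := norm_log_one_add_half_le_self h
    rw [add_sub_cancel] at h1
    calc _ ≤ 3 / 2 * ‖w - 1‖ := h1
      _ ≤ (2 * Real.pi + 3 + 2 / δ) * ‖w - 1‖ * 1 := by rw [mul_one]; gcongr; linarith
      _ ≤ _ := by gcongr; linarith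
  · push Not at h
    by_cases hw : w = 0
    · rw [hw, log_zero, norm_zero]; positivity
    have hw0 : 0 < ‖w‖ := norm_pos_iff.mpr hw
    have h1 : Real.log ‖w‖ ≤ 1 + ‖w - 1‖ := by
      have := norm_le_norm_add_norm_sub' w 1
      rw [norm_one] at this
      linarith [Real.log_le_sub_one_of_pos hw0]
    have h2 : -Real.log ‖w‖ ≤ ‖w‖ ^ (-δ) / δ := by
      have := Real.log_le_rpow_div (inv_nonneg.mpr hw0.le) hδ
      rwa [Real.log_inv, Real.inv_rpow hw0.le, ← Real.rpow_neg hw0.le] at this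
    have h3 : |Real.log ‖w‖| ≤ 1 + ‖w - 1‖ + ‖w‖ ^ (-δ) / δ := by
      have : 0 ≤ ‖w‖ ^ (-δ) / δ := by positivity
      rw [abs_le]; constructor <;> linarith
    have h4 := norm_le_abs_re_add_abs_im (log w)
    rw [log_re, log_im] at h4
    have h5 := abs_arg_le_pi w
    have h6 : ‖w‖ ^ (-δ) / δ ≤ 2 / δ * ‖w - 1‖ * ‖w‖ ^ (-δ) := by
      calc _ = 2 / δ * (1 / 2) * ‖w‖ ^ (-δ) := by ring
        _ ≤ _ := by gcongr
    calc ‖log w‖ ≤ 1 + ‖w - 1‖ + 2 / δ * ‖w - 1‖ * ‖w‖ ^ (-δ) + Real.pi := by linarith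
      _ ≤ (2 * Real.pi + 3) * ‖w - 1‖ + 2 / δ * ‖w - 1‖ * ‖w‖ ^ (-δ) := by nlinarith
      _ ≤ _ := by
        nlinarith [mul_nonneg hn hpos, mul_nonneg hpi.le (mul_nonneg hn hpos),
          mul_nonneg hδ'.le hn]

theorem norm_add_ofReal_sq_ge {b : ℂ} (hb : 0 ≤ b.re) {x : ℝ} (hx : 0 < x) :
    ‖b‖ ^ 2 + x ^ 2 ≤ ‖b + x‖ ^ 2 := by
  rw [← normSq_eq_norm_sq, ← normSq_eq_norm_sq, normSq_apply, normSq_apply]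
  simp
  nlinarith [mul_nonneg hb hx.le]

theorem norm_logRatio_sub_one_le {b : ℂ} (hb0 : b ≠ 0) (hb : 0 ≤ b.re) (t : ℝ) :
    ‖logRatio b (Real.exp t) - 1‖ ≤
      (1 + ‖b‖) ^ 2 * (1 + 1 / ‖b‖ ^ 2) * Real.exp (-|t|) := by
  have hx := Real.exp_pos t
  have hρ : 0 < ‖b‖ := norm_pos_iff.mpr hb0
  rw [logRatio_sub_one hb hx, norm_div, norm_mul, norm_pow, norm_pow, norm_real,
    Real.norm_of_nonneg hx.le, mul_assoc]
  have h1 : ‖1 - b‖ ≤ 1 + ‖b‖ := (norm_sub_le _ _).trans (by rw [norm_one])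
  have h2 := norm_add_ofReal_sq_ge hb hx
  have h3 : Real.exp t / (‖b‖ ^ 2 + Real.exp t ^ 2) ≤ (1 + 1 / ‖b‖ ^ 2) * Real.exp (-|t|) := by
    have hρ2 : 0 < 1 / ‖b‖ ^ 2 := by positivity
    rcases le_total 0 t with ht | ht
    · rw [abs_of_nonneg ht]
      calc _ ≤ Real.exp t / Real.exp t ^ 2 := by gcongr; linarith [sq_nonneg ‖b‖]
        _ = 1 * Real.exp (-t) := by rw [Real.exp_neg]; field_simp
        _ ≤ _ := by gcongr; linarith
    · rw [abs_of_nonpos ht, neg_neg]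
      calc _ ≤ Real.exp t / ‖b‖ ^ 2 := by gcongr; linarith [sq_nonneg (Real.exp t)]
        _ = 1 / ‖b‖ ^ 2 * Real.exp t := by ring
        _ ≤ _ := by gcongr; linarith
  calc _ ≤ Real.exp t * (1 + ‖b‖) ^ 2 / (‖b‖ ^ 2 + Real.exp t ^ 2) := by gcongr
    _ = (1 + ‖b‖) ^ 2 * (Real.exp t / (‖b‖ ^ 2 + Real.exp t ^ 2)) := by ring
    _ ≤ _ := by gcongr

/-- R can vanish only where x = -b², hence only at x = ‖b‖², which happens for imaginary b. The
bound depends on b through ‖b‖ alone, so it survives rotation of b. -/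
theorem norm_logRatio_ge {b : ℂ} (hb0 : b ≠ 0) (hb : 0 ≤ b.re) (t : ℝ) :
    (1 - Real.exp (-|t - Real.log (‖b‖ ^ 2)|)) / 2 ≤ ‖logRatio b (Real.exp t)‖ := by
  have hx := Real.exp_pos t
  have hρ : 0 < ‖b‖ := norm_pos_iff.mpr hb0
  have hρ2 : 0 < ‖b‖ ^ 2 := by positivity
  set x := Real.exp t with hxt
  have hbx : 0 < ‖b + x‖ := norm_pos_iff.mpr (add_ofReal_ne_zero hb hx)
  have h1 : ‖b + x‖ ^ 2 ≤ 2 * (‖b‖ ^ 2 + x ^ 2) := by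
    have := norm_add_le b x
    rw [norm_real, Real.norm_of_nonneg hx.le] at this
    nlinarith [sq_nonneg (‖b‖ - x), norm_nonneg (b + x)]
  have h2 : |x - ‖b‖ ^ 2| ≤ ‖b ^ 2 + x‖ := by
    have := abs_norm_sub_norm_le (x : ℂ) (-b ^ 2)
    rw [norm_real, Real.norm_of_nonneg hx.le, norm_neg, norm_pow, sub_neg_eq_add, add_comm] at this
    exact this
  have h3 : ‖(x : ℂ) + 1‖ = x + 1 := by
    rw [← ofReal_one, ← ofReal_add, norm_real, Real.norm_of_nonneg (by positivity)]
  rw [logRatio, norm_div, norm_mul, norm_pow, h3, div_le_div_iff₀ two_pos (by positivity)]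
  have h4 : (1 - Real.exp (-|t - Real.log (‖b‖ ^ 2)|)) * (‖b‖ ^ 2 + x ^ 2) ≤
      (x + 1) * |x - ‖b‖ ^ 2| := by
    rcases le_total (Real.log (‖b‖ ^ 2)) t with h | h
    · have h5 : ‖b‖ ^ 2 ≤ x := (Real.log_le_iff_le_exp hρ2).mp h
      rw [abs_of_nonneg (sub_nonneg.mpr h), abs_of_nonneg (sub_nonneg.mpr h5), neg_sub,
        Real.exp_sub, Real.exp_log hρ2, ← hxt, one_sub_div hx.ne', div_mul_eq_mul_div,
        div_le_iff₀ hx]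
      nlinarith [mul_nonneg (sub_nonneg.mpr h5) (sub_nonneg.mpr h5)]
    · have h5 : x ≤ ‖b‖ ^ 2 := (Real.le_log_iff_exp_le hρ2).mp h
      rw [abs_of_nonpos (sub_nonpos.mpr h), abs_of_nonpos (sub_nonpos.mpr h5), neg_neg,
        Real.exp_sub, Real.exp_log hρ2, ← hxt, one_sub_div hρ2.ne', div_mul_eq_mul_div,
        div_le_iff₀ hρ2]
      nlinarith [mul_nonneg (sub_nonneg.mpr h5) (mul_nonneg hx.le (sub_nonneg.mpr h5))]
  have h6 : 0 ≤ 1 - Real.exp (-|t - Real.log (‖b‖ ^ 2)|) :=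
    sub_nonneg.mpr (Real.exp_le_one_iff.mpr (by simp))
  calc _ ≤ (1 - Real.exp (-|t - Real.log (‖b‖ ^ 2)|)) * (2 * (‖b‖ ^ 2 + x ^ 2)) := by gcongr
    _ ≤ 2 * ((x + 1) * |x - ‖b‖ ^ 2|) := by linarith
    _ ≤ _ := by rw [mul_comm]; gcongr

theorem one_sub_exp_neg_rpow_le {u δ : ℝ} (hu : 0 < u) (hδ : 0 < δ) (hδ1 : δ ≤ 1) {r : ℝ}
    (hr : (1 - Real.exp (-u)) / 2 ≤ r) : r ^ (-δ) ≤ 2 * (1 + u ^ (-δ)) := by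
  -- From e^u ≥ 1 + u. Below, δ ≤ 1 enters through subadditivity of the δ-th power.
  have h1 : u / (1 + u) ≤ 1 - Real.exp (-u) := by
    have h2 : Real.exp (-u) ≤ 1 / (1 + u) := by
      rw [Real.exp_neg, ← one_div]
      gcongr
      linarith [Real.add_one_le_exp u]
    have h3 : u / (1 + u) = 1 - 1 / (1 + u) := by field_simp; ring
    linarith
  have h4 : u / (1 + u) / 2 ≤ r := by linarith
  calc r ^ (-δ) ≤ (u / (1 + u) / 2) ^ (-δ) :=
        Real.rpow_le_rpow_of_nonpos (by positivity) h4 (by linarith)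
    _ = (2 * (1 + u⁻¹)) ^ δ := by
        rw [Real.rpow_neg (by positivity), ← Real.inv_rpow (by positivity)]
        congr 1
        field_simp
        ring
    _ = 2 ^ δ * (1 + u⁻¹) ^ δ := Real.mul_rpow (by positivity) (by positivity)
    _ ≤ 2 ^ (1 : ℝ) * (1 ^ δ + u⁻¹ ^ δ) := by
        gcongr
        · norm_num
        · exact Real.rpow_add_le_add_rpow zero_le_one (by positivity) hδ.le hδ1
    _ = _ := by rw [Real.rpow_one, Real.one_rpow, Real.inv_rpow hu.le, Real.rpow_neg hu.le]

theorem exists_norm_log_logRatio_le {ρ δ : ℝ} (hρ : 0 < ρ) (hδ : 0 < δ) (hδ1 : δ ≤ 1) :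
    ∃ C, 0 ≤ C ∧ ∀ b : ℂ, ‖b‖ = ρ → 0 ≤ b.re → ∀ t : ℝ, t ≠ Real.log (ρ ^ 2) →
      ‖log (logRatio b (Real.exp t))‖ ≤
        C * Real.exp (-|t|) * (1 + |t - Real.log (ρ ^ 2)| ^ (-δ)) := by
  obtain ⟨C, hC0, hC⟩ := exists_norm_log_le hδ
  refine ⟨3 * C * ((1 + ρ) ^ 2 * (1 + 1 / ρ ^ 2)), by positivity, fun b hbρ hb t ht => ?_⟩
  have hb0 : b ≠ 0 := fun h => by rw [h, norm_zero] at hbρ; exact hρ.ne hbρ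
  have h1 := norm_logRatio_sub_one_le hb0 hb t
  have h2 := norm_logRatio_ge hb0 hb t
  rw [hbρ] at h1 h2
  have h3 := one_sub_exp_neg_rpow_le (abs_pos.mpr (sub_ne_zero.mpr ht)) hδ hδ1 h2
  set v := |t - Real.log (ρ ^ 2)| ^ (-δ) with hv
  have hv0 : 0 ≤ v := by positivity
  calc _ ≤ _ := hC _
    _ ≤ C * ((1 + ρ) ^ 2 * (1 + 1 / ρ ^ 2) * Real.exp (-|t|)) * (1 + 2 * (1 + v)) := by gcongr
    _ ≤ C * ((1 + ρ) ^ 2 * (1 + 1 / ρ ^ 2) * Real.exp (-|t|)) * (3 * (1 + v)) := by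
        gcongr; linarith
    _ = _ := by ring

/-! ### Integrable majorants, uniform under rotation of b and raising of α -/

theorem integrable_exp_mul_abs_sub_rpow {d ν : ℝ} (hd : 0 < d) (hν0 : 0 ≤ ν) (hν1 : ν < 1)
    (c : ℝ) : Integrable fun t : ℝ => Real.exp (-d * |t|) * |t - c| ^ (-ν) := by
  have h01 : IntervalIntegrable (fun t : ℝ => |t| ^ (-ν)) volume 0 1 := by
    refine (intervalIntegral.intervalIntegrable_rpow' (r := -ν) (by linarith)).congr
      fun t ht => ?_
    rw [uIoc_of_le zero_le_one] at ht
    simp only [abs_of_pos ht.1]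
  have h10 : IntervalIntegrable (fun t : ℝ => |t| ^ (-ν)) volume (-1) 0 := by
    have := ((IntervalIntegrable.iff_comp_neg (f := fun t : ℝ => |t| ^ (-ν))).mp h01).symm
    simpa using this
  have hloc : IntegrableOn (fun t : ℝ => |t - c| ^ (-ν)) (Ioc (-1 + c) (1 + c)) := by
    have := (h10.trans h01).comp_sub_right c
    rwa [intervalIntegrable_iff_integrableOn_Ioc_of_le (by linarith)] at this
  have hind := (integrable_indicator_iff measurableSet_Ioc).mpr hloc
  refine ((integrable_exp_neg_mul_abs hd).add hind).mono'
    (Measurable.aestronglyMeasurable (by fun_prop)) (ae_of_all _ fun t => ?_)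
  have he : Real.exp (-d * |t|) ≤ 1 := Real.exp_le_one_iff.mpr (by
    rw [neg_mul]; exact neg_nonpos.mpr (by positivity))
  have hv : 0 ≤ |t - c| ^ (-ν) := by positivity
  rw [Real.norm_of_nonneg (by positivity), Pi.add_apply]
  by_cases ht : t ∈ Ioc (-1 + c) (1 + c)
  · rw [indicator_of_mem ht]
    calc _ ≤ 1 * |t - c| ^ (-ν) := by gcongr
      _ ≤ _ := by rw [one_mul]; exact le_add_of_nonneg_left (Real.exp_pos _).le
  · rw [indicator_of_notMem ht, add_zero]
    refine mul_le_of_le_one_right (Real.exp_pos _).le ?_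
    refine Real.rpow_le_one_of_one_le_of_nonpos ?_ (by linarith)
    rw [mem_Ioc, not_and_or, not_lt, not_le] at ht
    rcases ht with h | h
    · rw [abs_of_nonpos (by linarith)]; linarith
    · rw [abs_of_nonneg (by linarith)]; linarith

theorem rpow_neg_le_one_add {w a ν : ℝ} (hw : 0 < w) (ha : 0 ≤ a) (haν : a ≤ ν) :
    w ^ (-a) ≤ 1 + w ^ (-ν) := by
  have hv : 0 ≤ w ^ (-ν) := by positivity
  rcases le_total 1 w with h | h
  · have := Real.rpow_le_one_of_one_le_of_nonpos h (neg_nonpos.mpr ha)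
    linarith
  · have := Real.rpow_le_rpow_of_exponent_ge hw h (neg_le_neg haν)
    linarith

/-- The two singular points may coincide, so the exponents must add; comparison with min u v turns
the product into a sum of separate singularities. -/
theorem one_add_rpow_mul_le {u v δ m : ℝ} (hu : 0 < u) (hv : 0 < v) (hδ : 0 ≤ δ) (hm : 0 ≤ m) :
    (1 + u ^ (-δ)) * (1 + v ^ (-m)) ≤ 4 * (1 + u ^ (-(δ + m)) + v ^ (-(δ + m))) := by
  set w := min u v with hw
  have hw0 : 0 < w := lt_min hu hv
  have h1 : u ^ (-δ) ≤ w ^ (-δ) :=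
    Real.rpow_le_rpow_of_nonpos hw0 (min_le_left _ _) (by linarith)
  have h2 : v ^ (-m) ≤ w ^ (-m) :=
    Real.rpow_le_rpow_of_nonpos hw0 (min_le_right _ _) (by linarith)
  have h3 := rpow_neg_le_one_add hw0 hδ (show δ ≤ δ + m by linarith)
  have h4 := rpow_neg_le_one_add hw0 hm (show m ≤ δ + m by linarith)
  have h5 : w ^ (-δ) * w ^ (-m) = w ^ (-(δ + m)) := by
    rw [← Real.rpow_add hw0]; congr 1; ring
  have h6 : w ^ (-(δ + m)) ≤ u ^ (-(δ + m)) + v ^ (-(δ + m)) := by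
    rcases min_choice u v with h | h
    · rw [hw, h]; exact le_add_of_nonneg_right (by positivity)
    · rw [hw, h]; exact le_add_of_nonneg_left (by positivity)
  calc _ ≤ (1 + w ^ (-δ)) * (1 + w ^ (-m)) := by gcongr
    _ = 1 + w ^ (-δ) + w ^ (-m) + w ^ (-δ) * w ^ (-m) := by ring
    _ ≤ _ := by rw [h5]; linarith [show 0 ≤ w ^ (-(δ + m)) by positivity]

/-- A singularity at t = -Re α is needed only when Im α > 0 fails and Re k < 0; then m = -Re k < 1.
Otherwise m = 0. -/
theorem exists_norm_add_mul_I_cpow_le {α k : ℂ} (h : 0 < α.im ∨ -1 < k.re) :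
    ∃ m C : ℝ, 0 ≤ m ∧ m < 1 ∧ 0 ≤ C ∧ ∀ ε : ℝ, 0 ≤ ε → ε ≤ 1 → ∀ t : ℝ, t ≠ -α.re →
      ‖(α + ε * I + t) ^ k‖ ≤ C * Real.exp (1 / 2 * |t|) * (1 + |t - -α.re| ^ (-m)) := by
  have hup : ∀ ε : ℝ, 0 ≤ ε → ε ≤ 1 → ∀ t : ℝ, ‖α + ε * I + t‖ ≤ ‖α‖ + 1 + |t| := by
    intro ε h0 h1 t
    have h2 := norm_add_le (α + ε * I) t
    have h3 := norm_add_le α (ε * I)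
    rw [norm_mul, norm_I, mul_one, norm_real, Real.norm_of_nonneg h0] at h3
    rw [norm_real, Real.norm_eq_abs] at h2
    linarith
  by_cases hα' : 0 < α.im
  · obtain ⟨C, hC0, hC⟩ := exists_norm_cpow_le_exp hα' (A := ‖α‖ + 1) (by positivity)
      (norm_nonneg k) (ε := 1 / 2) (by norm_num)
    refine ⟨0, C, le_rfl, one_pos, hC0, fun ε h0 h1 t _ => ?_⟩
    refine (hC _ _ t ?_ (hup ε h0 h1 t) le_rfl).trans ?_
    · have := (le_abs_self _).trans (abs_im_le_norm (α + ε * I + t))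
      simp at this
      linarith
    · exact le_mul_of_one_le_right (by positivity) (le_add_of_nonneg_right (by positivity))
  have hk : -1 < k.re := h.resolve_left hα'
  rcases le_total 0 k.re with hk0 | hk0
  · obtain ⟨C, hC0, hC⟩ := exists_add_abs_rpow_le_exp (A := ‖α‖ + 1) (by positivity) hk0
      (ε := 1 / 2) (by norm_num)
    refine ⟨0, C * Real.exp (Real.pi * |k.im|), le_rfl, one_pos, by positivity,
      fun ε h0 h1 t _ => ?_⟩
    refine (norm_cpow_le_rpow_mul_exp _ _).trans ?_
    calc _ ≤ (C * Real.exp (1 / 2 * |t|)) * Real.exp (Real.pi * |k.im|) := by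
          gcongr
          exact (Real.rpow_le_rpow (norm_nonneg _) (hup ε h0 h1 t) hk0).trans (hC t)
      _ = C * Real.exp (Real.pi * |k.im|) * Real.exp (1 / 2 * |t|) := by ring
      _ ≤ _ := le_mul_of_one_le_right (by positivity) (le_add_of_nonneg_right (by positivity))
  · refine ⟨-k.re, Real.exp (Real.pi * |k.im|), by linarith, by linarith, by positivity,
      fun ε h0 h1 t ht => ?_⟩
    refine (norm_cpow_le_rpow_mul_exp _ _).trans ?_
    rw [neg_neg]
    have hpos : 0 < |t - -α.re| := abs_pos.mpr (sub_ne_zero.mpr ht)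
    have hle : |t - -α.re| ≤ ‖α + ε * I + t‖ := by
      have := abs_re_le_norm (α + ε * I + t)
      simp at this
      rwa [sub_neg_eq_add, add_comm]
    have h1 : ‖α + ε * I + t‖ ^ k.re ≤ |t - -α.re| ^ k.re :=
      Real.rpow_le_rpow_of_nonpos hpos hle hk0
    have h2 : 1 ≤ Real.exp (1 / 2 * |t|) := Real.one_le_exp (by positivity)
    have h3 : 0 ≤ |t - -α.re| ^ k.re := by positivity
    have h4 := Real.exp_pos (Real.pi * |k.im|)
    calc _ ≤ (1 + |t - -α.re| ^ k.re) * Real.exp (Real.pi * |k.im|) := by gcongr; linarith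
      _ = Real.exp (Real.pi * |k.im|) * 1 * (1 + |t - -α.re| ^ k.re) := by ring
      _ ≤ _ := by gcongr

theorem exists_integrable_majorant {α k : ℂ} (h : 0 < α.im ∨ -1 < k.re)
    {ρ : ℝ} (hρ : 0 < ρ) :
    ∃ g : ℝ → ℝ, Integrable g ∧ ∀ ε : ℝ, 0 ≤ ε → ε ≤ 1 → ∀ b : ℂ, ‖b‖ = ρ → 0 ≤ b.re →
      ∀ᵐ t : ℝ, ‖log (logRatio b (Real.exp t)) * (α + ε * I + t) ^ k‖ ≤ g t := by
  obtain ⟨m, C, hm0, hm1, hC0, hC⟩ := exists_norm_add_mul_I_cpow_le h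
  -- Then δ + m = (1 + m)/2 < 1, so even coinciding singularities stay integrable.
  set δ := (1 - m) / 2 with hδ
  obtain ⟨D, hD0, hD⟩ := exists_norm_log_logRatio_le hρ (δ := δ) (by rw [hδ]; linarith)
    (by rw [hδ]; linarith)
  set c := Real.log (ρ ^ 2) with hc
  refine ⟨fun t => 4 * (C * D) * (Real.exp (-(1 / 2) * |t|)
    + Real.exp (-(1 / 2) * |t|) * |t - c| ^ (-(δ + m))
    + Real.exp (-(1 / 2) * |t|) * |t - -α.re| ^ (-(δ + m))), ?_, ?_⟩
  · have hν : δ + m < 1 := by rw [hδ]; linarith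
    have hν0 : 0 ≤ δ + m := by rw [hδ]; linarith
    exact (((integrable_exp_neg_mul_abs (by norm_num)).add
      (integrable_exp_mul_abs_sub_rpow (by norm_num) hν0 hν c)).add
      (integrable_exp_mul_abs_sub_rpow (by norm_num) hν0 hν (-α.re))).const_mul _
  · intro ε h0 h1 b hbρ hb
    have hne : ∀ x : ℝ, ∀ᵐ t : ℝ, t ≠ x := fun x => by simp [ae_iff]
    filter_upwards [hne c, hne (-α.re)] with t ht1 ht2
    have hu : 0 < |t - c| := abs_pos.mpr (sub_ne_zero.mpr ht1)
    have hv : 0 < |t - -α.re| := abs_pos.mpr (sub_ne_zero.mpr ht2)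
    have hδ0 : 0 ≤ δ := by rw [hδ]; linarith
    rw [norm_mul]
    calc _ ≤ (D * Real.exp (-|t|) * (1 + |t - c| ^ (-δ))) *
          (C * Real.exp (1 / 2 * |t|) * (1 + |t - -α.re| ^ (-m))) := by
          gcongr
          exacts [hD b hbρ hb t ht1, hC ε h0 h1 t ht2]
      _ = C * D * (Real.exp (-|t|) * Real.exp (1 / 2 * |t|)) *
          ((1 + |t - c| ^ (-δ)) * (1 + |t - -α.re| ^ (-m))) := by ring
      _ ≤ C * D * Real.exp (-(1 / 2) * |t|) *
          (4 * (1 + |t - c| ^ (-(δ + m)) + |t - -α.re| ^ (-(δ + m)))) := by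
          rw [← Real.exp_add, show -|t| + 1 / 2 * |t| = -(1 / 2) * |t| by ring]
          exact mul_le_mul_of_nonneg_left (one_add_rpow_mul_le hu hv hδ0 hm0) (by positivity)
      _ = _ := by ring

theorem measurable_log_logRatio_mul (α b k : ℂ) :
    Measurable fun t : ℝ => log (logRatio b (Real.exp t)) * (α + t) ^ k := by
  unfold logRatio
  fun_prop

theorem integrable_log_logRatio_mul {α k b : ℂ} (h : 0 < α.im ∨ -1 < k.re)
    (hb0 : b ≠ 0) (hb : 0 ≤ b.re) :
    Integrable fun t : ℝ => log (logRatio b (Real.exp t)) * (α + t) ^ k := by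
  obtain ⟨g, hg, hle⟩ := exists_integrable_majorant h (norm_pos_iff.mpr hb0)
  exact hg.mono' (measurable_log_logRatio_mul α b k).aestronglyMeasurable
    (by simpa using hle 0 le_rfl zero_le_one b rfl hb)

/-! ### Two integrations by parts for Re b > 0 and Im α > 0 -/

theorem sq_mem_slitPlane {b : ℂ} (hb : 0 < b.re) : b ^ 2 ∈ slitPlane := by
  rw [mem_slitPlane_iff]
  by_cases h : b.im = 0
  · left; simp [sq, h]; positivity
  · right; simp only [sq, mul_im]
    have := mul_ne_zero hb.ne' h
    intro h'
    apply this
    linarith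

theorem log_sq {b : ℂ} (hb : 0 < b.re) : log (b ^ 2) = 2 * log b := by
  have h := abs_lt.mp (abs_arg_lt_pi_div_two_iff.mpr (.inl hb))
  have hb0 : b ≠ 0 := fun h => by simp [h] at hb
  rw [sq, log_mul hb0 hb0 (by constructor <;> linarith [h.1, h.2])]
  ring

/-- The logarithmic derivative, in `t`, of `logRatio b (e ^ t)`. -/
noncomputable def logRatioLogDeriv (b : ℂ) (t : ℝ) : ℂ :=
  exp t / (1 + exp t) + exp t / (b ^ 2 + exp t) - 2 * (exp t / (b + exp t))

theorem hasDerivAt_log_logRatio {b : ℂ} (hb : 0 < b.re) (t : ℝ) :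
    HasDerivAt (fun t : ℝ => log (logRatio b (Real.exp t))) (logRatioLogDeriv b t) t := by
  have hx := Real.exp_pos t
  have h1 : HasDerivAt (fun t : ℝ => exp (t : ℂ)) (exp t) t := by
    simpa using (hasDerivAt_exp (t : ℂ)).comp_ofReal
  have n1 : 1 + exp (t : ℂ) ≠ 0 := add_exp_ne_zero one_mem_slitPlane t
  have n1' : exp (t : ℂ) + 1 ≠ 0 := by rwa [add_comm]
  have n2 : b ^ 2 + exp (t : ℂ) ≠ 0 := add_exp_ne_zero (sq_mem_slitPlane hb) t
  have n3 : b + exp (t : ℂ) ≠ 0 := add_exp_ne_zero (.inl hb) t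
  have h2 := ((h1.add_const 1).mul (h1.const_add (b ^ 2))).div ((h1.const_add b).pow 2)
    (pow_ne_zero 2 n3)
  have hmem := logRatio_mem_slitPlane hb.le hx (sq_add_ofReal_ne_zero hb hx)
  have h3 := (h2.congr_of_eventuallyEq (f₁ := fun t : ℝ => logRatio b (Real.exp t))
    (.of_eq (by ext t; simp [logRatio]))).clog_real hmem
  refine h3.congr_deriv ?_
  simp only [logRatio, ofReal_exp, logRatioLogDeriv, Pi.mul_apply, Pi.pow_apply]
  field_simp
  ring

theorem hasDerivAt_logRatioLogDeriv {b : ℂ} (hb : 0 < b.re) (t : ℝ) :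
    HasDerivAt (logRatioLogDeriv b)
      (logisticKernel 1 t + logisticKernel (b ^ 2) t - 2 * logisticKernel b t) t :=
  ((hasDerivAt_exp_div_add_exp one_mem_slitPlane t).add
    (hasDerivAt_exp_div_add_exp (sq_mem_slitPlane hb) t)).sub
    ((hasDerivAt_exp_div_add_exp (.inl hb) t).const_mul 2)

theorem exists_norm_logRatioLogDeriv_le {b : ℂ} (hb : 0 < b.re) :
    ∃ C, 0 ≤ C ∧ ∀ t : ℝ, ‖logRatioLogDeriv b t‖ ≤ C * Real.exp (-|t|) := by
  obtain ⟨κ, hκ, h⟩ := exists_le_norm_add_ofReal (B := b) (.inl hb)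
  obtain ⟨κ', hκ', h'⟩ := exists_le_norm_add_ofReal (sq_mem_slitPlane hb)
  refine ⟨‖1 - b‖ ^ 2 * (1 + ‖b‖) / (κ * κ'), by positivity, fun t => ?_⟩
  have n1 : 1 + exp (t : ℂ) ≠ 0 := add_exp_ne_zero one_mem_slitPlane t
  have n2 : b ^ 2 + exp (t : ℂ) ≠ 0 := add_exp_ne_zero (sq_mem_slitPlane hb) t
  have n3 : b + exp (t : ℂ) ≠ 0 := add_exp_ne_zero (.inl hb) t
  -- At +∞ the three terms tend to 1 + 1 - 2 = 0; the common denominator makes this cancellation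
  -- visible.
  have heq : logRatioLogDeriv b t = (1 - b) ^ 2 * exp t * (b - exp t) /
      ((1 + exp t) * (b ^ 2 + exp t) * (b + exp t)) := by
    rw [logRatioLogDeriv]
    field_simp
    ring
  have hx := Real.exp_pos t
  have hb1 := h _ hx.le
  have hb2 := h' _ hx.le
  rw [heq, ← ofReal_exp]
  have e1 : ‖1 + (Real.exp t : ℂ)‖ = 1 + Real.exp t := by
    rw [← ofReal_one, ← ofReal_add, norm_real, Real.norm_of_nonneg (by positivity)]
  have e2 : ‖b - (Real.exp t : ℂ)‖ ≤ (1 + ‖b‖) * (1 + Real.exp t) := by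
    have := norm_sub_le b (Real.exp t : ℂ)
    rw [norm_real, Real.norm_of_nonneg hx.le] at this
    nlinarith [mul_nonneg (norm_nonneg b) hx.le]
  rw [norm_div, norm_mul, norm_mul, norm_mul, norm_mul, norm_pow, e1, norm_real,
    Real.norm_of_nonneg hx.le]
  calc _ ≤ ‖1 - b‖ ^ 2 * Real.exp t * ((1 + ‖b‖) * (1 + Real.exp t)) /
        ((1 + Real.exp t) * (κ' * (1 + Real.exp t)) * (κ * (1 + Real.exp t))) := by gcongr
    _ = ‖1 - b‖ ^ 2 * (1 + ‖b‖) / (κ * κ') * (Real.exp t / (1 + Real.exp t) ^ 2) := by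
        field_simp
    _ ≤ _ := by gcongr; exact exp_div_one_add_exp_sq_le t

theorem hasDerivAt_add_cpow_div {α : ℂ} (hα : 0 < α.im) {p : ℂ} (hp : p + 1 ≠ 0) (t : ℝ) :
    HasDerivAt (fun t : ℝ => (α + t) ^ (p + 1) / (p + 1)) ((α + t) ^ p) t := by
  have h1 := (((hasDerivAt_id (t : ℂ)).const_add α).cpow_const (c := p + 1)
    (.inr (by simpa using hα.ne'))).comp_ofReal.div_const (p + 1)
  refine h1.congr_deriv ?_
  simp only [id_eq, add_sub_cancel_right, mul_one]
  field_simp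

/-- Differentiation moves from log R to the power twice, raising k to k + 2. Integrability of each
product replaces the boundary terms. -/
theorem integral_log_logRatio_mul_eq_logisticMoment {α k b : ℂ} (hα : 0 < α.im) (hb : 0 < b.re)
    (hk1 : k + 1 ≠ 0) (hk2 : k + 2 ≠ 0) :
    ∫ t : ℝ, log (logRatio b (Real.exp t)) * (α + t) ^ k =
      (logisticMoment (k + 2) α 1 + logisticMoment (k + 2) α (b ^ 2)
        - 2 * logisticMoment (k + 2) α b) / ((k + 1) * (k + 2)) := by
  have hb0 : b ≠ 0 := fun h => by simp [h] at hb
  have hk2' : k + 1 + 1 ≠ 0 := by rwa [add_assoc, one_add_one_eq_two]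
  have hcont : Continuous (logRatioLogDeriv b) :=
    continuous_iff_continuousAt.mpr fun t => (hasDerivAt_logRatioLogDeriv hb t).continuousAt
  obtain ⟨D, -, hD⟩ := exists_norm_logRatioLogDeriv_le hb
  have hint : ∀ p : ℂ, Integrable fun t : ℝ => logRatioLogDeriv b t * (α + t) ^ p := fun p => by
    obtain ⟨C, -, hC⟩ := exists_norm_add_ofReal_cpow_le hα p (ε := 1 / 2) (by norm_num)
    simpa only [mul_comm] using integrable_mul_of_norm_le_exp
      (continuous_add_ofReal_cpow hα p).aestronglyMeasurable hcont.aestronglyMeasurable hC hD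
  have hk : ∀ B : ℂ, B ∈ slitPlane →
      Integrable fun t : ℝ => (α + t) ^ (k + 2) * logisticKernel B t :=
    fun B hB => integrable_add_cpow_mul_logisticKernel hα hB _
  have i1 := hk 1 one_mem_slitPlane
  have i2 := hk (b ^ 2) (sq_mem_slitPlane hb)
  have i3 := hk b (.inl hb)
  have i12 : Integrable fun t : ℝ => (α + t) ^ (k + 2) * logisticKernel 1 t
    + (α + t) ^ (k + 2) * logisticKernel (b ^ 2) t := i1.add i2
  have hsum : ∀ t : ℝ, (logisticKernel 1 t + logisticKernel (b ^ 2) t - 2 * logisticKernel b t) *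
      ((α + t) ^ (k + 2) / (k + 2)) = (k + 2)⁻¹ * ((α + t) ^ (k + 2) * logisticKernel 1 t
    + (α + t) ^ (k + 2) * logisticKernel (b ^ 2) t
    - 2 * ((α + t) ^ (k + 2) * logisticKernel b t)) := fun t => by ring
  have ibp1 := integral_mul_deriv_eq_deriv_mul_of_integrable (fun t _ => hasDerivAt_log_logRatio hb t)
    (fun t _ => hasDerivAt_add_cpow_div hα hk1 t) (integrable_log_logRatio_mul (.inl hα) hb0 hb.le)
    (by
      have := (hint (k + 1)).div_const (k + 1)
      refine this.congr (ae_of_all _ fun t => ?_)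
      simp only [Pi.mul_apply, mul_div_assoc])
    (by
      have := (integrable_log_logRatio_mul (k := k + 1) (.inl hα) hb0 hb.le).div_const (k + 1)
      refine this.congr (ae_of_all _ fun t => ?_)
      simp only [Pi.mul_apply, mul_div_assoc])
  have ibp2 := integral_mul_deriv_eq_deriv_mul_of_integrable (fun t _ => hasDerivAt_logRatioLogDeriv hb t)
    (fun t _ => hasDerivAt_add_cpow_div hα hk2' t) (hint (k + 1))
    (by
      rw [add_assoc, one_add_one_eq_two]
      refine ((i12.sub (i3.const_mul 2)).const_mul (k + 2)⁻¹).congr (ae_of_all _ fun t => ?_)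
      simp only [Pi.mul_apply, hsum, Pi.sub_apply])
    (by
      have := (hint (k + 1 + 1)).div_const (k + 1 + 1)
      refine this.congr (ae_of_all _ fun t => ?_)
      simp only [Pi.mul_apply, mul_div_assoc])
  rw [add_assoc k, one_add_one_eq_two] at ibp2
  simp only [hsum] at ibp2
  rw [integral_const_mul, integral_sub i12 (i3.const_mul 2), integral_add i1 i2,
    integral_const_mul] at ibp2
  rw [ibp1]
  simp only [← mul_div_assoc]
  rw [integral_div, ibp2]
  unfold logisticMoment
  field_simp

/-- The closed form of the integral, in terms of `α = log a` and `β = log b`. -/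
noncomputable def hurwitzCombination (k α β : ℂ) : ℂ :=
  (2 * Real.pi * I) ^ (k + 2) / (k + 1) *
    (2 * hurwitzZetaC (-k - 1) ((α + β + Real.pi * I) / (2 * Real.pi * I))
      - hurwitzZetaC (-k - 1) ((α + 2 * β + Real.pi * I) / (2 * Real.pi * I))
      - hurwitzZetaC (-k - 1) ((α + Real.pi * I) / (2 * Real.pi * I)))

/-- The kernels B = 1, b², b give zeta arguments with log B = 0, 2 log b, log b; the middle one uses
Re b > 0. -/
theorem integral_log_logRatio_mul_of_pos {α k b : ℂ} (hα : 0 < α.im) (hb : 0 < b.re)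
    (hk1 : k + 1 ≠ 0) (hk2 : k + 2 ≠ 0) :
    ∫ t : ℝ, log (logRatio b (Real.exp t)) * (α + t) ^ k = hurwitzCombination k α (log b) := by
  have h1 := mul_hurwitzZetaC_eq_neg_logisticMoment hα one_mem_slitPlane hk2
  have h2 := mul_hurwitzZetaC_eq_neg_logisticMoment hα (sq_mem_slitPlane hb) hk2
  have h3 := mul_hurwitzZetaC_eq_neg_logisticMoment hα (B := b) (.inl hb) hk2
  rw [log_one, add_zero] at h1
  rw [log_sq hb] at h2
  rw [integral_log_logRatio_mul_eq_logisticMoment hα hb hk1 hk2, hurwitzCombination,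
    show -k - 1 = 1 - (k + 2) by ring, div_mul_eq_mul_div,
    div_eq_div_iff (mul_ne_zero hk1 hk2) hk1]
  linear_combination (k + 1) * h1 + (k + 1) * h2 - 2 * (k + 1) * h3

/-! ### Passage to the boundary Im α = 0 or Re b = 0 -/

/-- On the cut the principal logarithm is continuous from above, and z + εi approaches from above.
-/
theorem tendsto_add_mul_I_cpow {z : ℂ} (hz : 0 ≤ z.im) (hz0 : z ≠ 0) (k : ℂ) :
    Tendsto (fun ε : ℝ => (z + ε * I) ^ k) (𝓝[>] 0) (𝓝 (z ^ k)) := by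
  have hlin : Tendsto (fun ε : ℝ => z + ε * I) (𝓝[>] 0) (𝓝 z) := by
    refine tendsto_nhdsWithin_of_tendsto_nhds ?_
    have : Continuous fun ε : ℝ => z + ε * I := by fun_prop
    simpa using this.tendsto 0
  by_cases h : z ∈ slitPlane
  · exact hlin.cpow tendsto_const_nhds h
  rw [mem_slitPlane_iff, not_or, not_lt, not_not] at h
  have hre : z.re < 0 := lt_of_le_of_ne h.1 fun h0 => hz0 (Complex.ext h0 h.2)
  have hlog : Tendsto (fun ε : ℝ => log (z + ε * I)) (𝓝[>] 0) (𝓝 (log z)) := by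
    refine (continuousWithinAt_log_of_re_neg_of_im_zero hre h.2).tendsto.comp
      (tendsto_nhdsWithin_iff.mpr ⟨hlin, ?_⟩)
    filter_upwards [self_mem_nhdsWithin] with ε hε
    have : 0 < ε := hε
    simp only [add_im, mul_im, ofReal_re, I_im, mul_one, ofReal_im, I_re,
      mul_zero, add_zero]
    linarith
  have h1 := ((continuous_exp.tendsto _).comp (hlog.mul_const k))
  rw [cpow_def_of_ne_zero hz0]
  refine h1.congr' ?_
  have hne : ∀ᶠ ε : ℝ in 𝓝[>] 0, z + ε * I ≠ 0 := hlin.eventually_ne hz0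
  filter_upwards [hne] with ε hε
  rw [cpow_def_of_ne_zero hε, Function.comp_apply]

/-- The rotation of `b` towards the positive real axis by the fraction `ε` of its argument. -/
noncomputable def rotateToReal (b : ℂ) (ε : ℝ) : ℂ := ‖b‖ * exp ((1 - ε) * arg b * I)

theorem norm_rotateToReal (b : ℂ) (ε : ℝ) : ‖rotateToReal b ε‖ = ‖b‖ := by
  rw [rotateToReal, show ((1 - ε) * arg b * I : ℂ) = (((1 - ε) * arg b : ℝ) : ℂ) * I by
    push_cast; ring, norm_mul, norm_exp_ofReal_mul_I, mul_one, norm_real, norm_norm]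

theorem log_rotateToReal {b : ℂ} (hb0 : b ≠ 0) {ε : ℝ} (h0 : 0 ≤ ε) (h1 : ε < 1) :
    log (rotateToReal b ε) = Real.log ‖b‖ + (1 - ε) * arg b * I := by
  have hb := norm_pos_iff.mpr hb0
  have hpi := Real.pi_pos
  have h2 := neg_pi_lt_arg b
  have h3 := arg_le_pi b
  rw [rotateToReal, log_ofReal_mul hb (exp_ne_zero _), log_exp]
  · have : ((1 - ε) * arg b * I : ℂ).im = (1 - ε) * arg b := by simp
    rw [this]
    nlinarith
  · have : ((1 - ε) * arg b * I : ℂ).im = (1 - ε) * arg b := by simp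
    rw [this]
    nlinarith

/-- Rotation keeps ‖b‖ fixed, hence keeps the majorant, while moving b into the open half-plane. -/
theorem rotateToReal_re_pos {b : ℂ} (hb0 : b ≠ 0) (hb : 0 ≤ b.re) {ε : ℝ} (h0 : 0 < ε)
    (h1 : ε < 1) : 0 < (rotateToReal b ε).re := by
  have hne : rotateToReal b ε ≠ 0 := norm_pos_iff.mp (by
    rw [norm_rotateToReal]; exact norm_pos_iff.mpr hb0)
  have harg : arg (rotateToReal b ε) = (1 - ε) * arg b := by
    rw [← log_im, log_rotateToReal hb0 h0.le h1]; simp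
  have h2 := abs_le.mp (abs_arg_le_pi_div_two_iff.mpr hb)
  have hpi := Real.pi_pos
  refine (abs_arg_lt_pi_div_two_iff.mp ?_).resolve_right hne
  rw [harg, abs_lt]
  constructor <;> nlinarith

theorem tendsto_rotateToReal (b : ℂ) : Tendsto (rotateToReal b) (𝓝[>] 0) (𝓝 b) := by
  refine tendsto_nhdsWithin_of_tendsto_nhds ?_
  have h : Continuous (rotateToReal b) := by unfold rotateToReal; fun_prop
  have h2 := h.tendsto 0
  rwa [show rotateToReal b 0 = b by simp [rotateToReal]] at h2

theorem tendsto_log_logRatio {b : ℂ} (hb : 0 ≤ b.re) {x : ℝ} (hx : 0 < x) (h : b ^ 2 + x ≠ 0) :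
    Tendsto (fun ε => log (logRatio (rotateToReal b ε) x)) (𝓝[>] 0) (𝓝 (log (logRatio b x))) := by
  have hbx := add_ofReal_ne_zero hb hx
  have hc : ContinuousAt (fun b => logRatio b x) b := by
    unfold logRatio
    exact ContinuousAt.div (by fun_prop) (by fun_prop) (pow_ne_zero 2 hbx)
  exact (hc.tendsto.comp (tendsto_rotateToReal b)).clog (logRatio_mem_slitPlane hb hx h)

theorem tendsto_integral_log_logRatio {α k b : ℂ} (hα : 0 ≤ α.im) (h : 0 < α.im ∨ -1 < k.re)
    (hb0 : b ≠ 0) (hb : 0 ≤ b.re) :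
    Tendsto (fun ε : ℝ => ∫ t : ℝ, log (logRatio (rotateToReal b ε) (Real.exp t)) *
        (α + ε * I + t) ^ k) (𝓝[>] 0)
      (𝓝 (∫ t : ℝ, log (logRatio b (Real.exp t)) * (α + t) ^ k)) := by
  obtain ⟨g, hg, hle⟩ := exists_integrable_majorant h (norm_pos_iff.mpr hb0)
  have hε : ∀ᶠ ε : ℝ in 𝓝[>] 0, 0 < ε ∧ ε < 1 := Ioo_mem_nhdsGT one_pos
  refine tendsto_integral_filter_of_dominated_convergence g (.of_forall fun ε =>
    (measurable_log_logRatio_mul _ _ _).aestronglyMeasurable) ?_ hg ?_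
  · filter_upwards [hε] with ε h
    exact hle ε h.1.le h.2.le _ (norm_rotateToReal b ε) (rotateToReal_re_pos hb0 hb h.1 h.2).le
  · have hne : ∀ x : ℝ, ∀ᵐ t : ℝ, t ≠ x := fun x => by simp [ae_iff]
    filter_upwards [hne (Real.log (‖b‖ ^ 2)), hne (-α.re)] with t ht1 ht2
    refine (tendsto_log_logRatio hb (Real.exp_pos t) fun h0 => ht1 ?_).mul ?_
    · have h1 := congrArg norm (eq_neg_of_add_eq_zero_left h0)
      rw [norm_pow, norm_neg, norm_real, Real.norm_of_nonneg (Real.exp_pos t).le] at h1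
      rw [h1, Real.log_exp]
    · have hz := tendsto_add_mul_I_cpow (z := α + t) (by simpa using hα)
        (fun h0 => ht2 (by have := congrArg re h0; simp at this; linarith)) k
      refine hz.congr fun ε => ?_
      rw [add_right_comm]

theorem div_two_pi_I_re (w : ℂ) :
    ((w + Real.pi * I) / (2 * Real.pi * I)).re = (w.im + Real.pi) / (2 * Real.pi) := by
  have h : (w + Real.pi * I) / (2 * Real.pi * I) =
      ((2 * Real.pi : ℝ) : ℂ)⁻¹ * (-I * (w + Real.pi * I)) := by
    have hpi : (Real.pi : ℂ) ≠ 0 := ofReal_ne_zero.mpr Real.pi_ne_zero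
    push_cast
    field_simp
    linear_combination (w + Real.pi * I) * I_sq
  rw [h, ← ofReal_inv, re_ofReal_mul]
  simp
  ring

theorem integral_log_logRatio_mul {α k b : ℂ} (hα : 0 ≤ α.im) (h : 0 < α.im ∨ -1 < k.re)
    (hb0 : b ≠ 0) (hb : 0 ≤ b.re) (hk1 : k + 1 ≠ 0) (hk2 : k + 2 ≠ 0) :
    ∫ t : ℝ, log (logRatio b (Real.exp t)) * (α + t) ^ k = hurwitzCombination k α (log b) := by
  have hε : ∀ᶠ ε : ℝ in 𝓝[>] 0, 0 < ε ∧ ε < 1 := Ioo_mem_nhdsGT one_pos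
  refine tendsto_nhds_unique (tendsto_integral_log_logRatio hα h hb0 hb) ?_
  have hα' : Tendsto (fun ε : ℝ => α + ε * I) (𝓝[>] 0) (𝓝 α) := by
    refine tendsto_nhdsWithin_of_tendsto_nhds ?_
    have : Continuous fun ε : ℝ => α + ε * I := by fun_prop
    simpa using this.tendsto 0
  have hβ : Tendsto (fun ε : ℝ => (Real.log ‖b‖ + (1 - ε) * arg b * I : ℂ)) (𝓝[>] 0)
      (𝓝 (log b)) := by
    refine tendsto_nhdsWithin_of_tendsto_nhds ?_
    have : Continuous fun ε : ℝ => (Real.log ‖b‖ + (1 - ε) * arg b * I : ℂ) := by fun_prop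
    have h2 := this.tendsto 0
    simpa [log] using h2
  have hargb := abs_le.mp (abs_arg_le_pi_div_two_iff.mpr hb)
  have hpi := Real.pi_pos
  have hs1 : -k - 1 ≠ 1 := fun h => hk2 (by linear_combination -h)
  have hs0 : -k - 1 ≠ 0 := fun h => hk1 (by linear_combination -h)
  -- Im w ≥ Im α - π covers w = α + 2 log b, since arg b ≥ -π/2, and yields Re q ≥ 0. The value q =
  -- 0 can arise only if Im α = 0; then Re k > -1 makes Re(-k - 1) < 0, as continuity at 0 requires.
  have hz : ∀ (f : ℝ → ℂ) (w : ℂ), Tendsto f (𝓝[>] 0) (𝓝 w) → α.im - Real.pi ≤ w.im →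
      Tendsto (fun ε => hurwitzZetaC (-k - 1) ((f ε + Real.pi * I) / (2 * Real.pi * I))) (𝓝[>] 0)
        (𝓝 (hurwitzZetaC (-k - 1) ((w + Real.pi * I) / (2 * Real.pi * I)))) := by
    intro f w hf hw
    refine (continuousAt_hurwitzZetaC hs1 hs0 ?_ ?_).tendsto.comp ((hf.add_const _).div_const _)
    · rw [div_two_pi_I_re]
      exact div_nonneg (by linarith) (by positivity)
    · rcases h with h | h
      · refine .inl fun h0 => ?_
        have h1 := div_two_pi_I_re w
        rw [h0, zero_re] at h1
        have h2 : 0 < (w.im + Real.pi) / (2 * Real.pi) := div_pos (by linarith) (by positivity)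
        linarith
      · right
        simp only [sub_re, neg_re, one_re]
        linarith
  have hlim : Tendsto (fun ε : ℝ => hurwitzCombination k (α + ε * I)
      (Real.log ‖b‖ + (1 - ε) * arg b * I)) (𝓝[>] 0) (𝓝 (hurwitzCombination k α (log b))) := by
    refine Tendsto.const_mul _ (((Tendsto.const_mul _ (hz _ _ (hα'.add hβ) ?_)).sub
      (hz _ _ (hα'.add (hβ.const_mul 2)) ?_)).sub (hz _ _ hα' ?_))
    · rw [add_im, log_im]; linarith
    · have : (2 * log b).im = 2 * arg b := by simp [log_im]
      rw [add_im, this]; linarith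
    · linarith
  refine hlim.congr' ?_
  filter_upwards [hε] with ε h
  rw [integral_log_logRatio_mul_of_pos (by simp; linarith [h.1])
    (rotateToReal_re_pos hb0 hb h.1 h.2) hk1 hk2, log_rotateToReal hb0 h.1.le h.2]

/-! ### Nonnegative integer k, with α arbitrary -/

theorem integral_log_logRatio_mul_natCast {b : ℂ} (hb0 : b ≠ 0) (hb : 0 ≤ b.re) (n : ℕ) (α : ℂ) :
    ∫ t : ℝ, log (logRatio b (Real.exp t)) * (α + t) ^ (n : ℂ) =
      hurwitzCombination n α (log b) := by
  have hint : ∀ j : ℕ, Integrable fun t : ℝ =>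
      (t : ℂ) ^ j * log (logRatio b (Real.exp t)) := fun j => by
    have := integrable_log_logRatio_mul (α := 0) (k := j) (b := b)
      (.inr (by rw [natCast_re]; linarith [(Nat.cast_nonneg j : (0 : ℝ) ≤ j)])) hb0 hb
    simpa [mul_comm] using this
  obtain ⟨P, hP⟩ := exists_polynomial_integral_add_pow hint n
  obtain ⟨Q, hQ⟩ := exists_polynomial_hurwitzZetaC (Nat.succ_ne_zero n)
  have hs : (-n - 1 : ℂ) = -((n + 1 : ℕ) : ℂ) := by push_cast; ring
  set A : ℂ → Polynomial ℂ := fun w => Q.comp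
    (Polynomial.C (2 * Real.pi * I)⁻¹ * (Polynomial.X + Polynomial.C (w + Real.pi * I))) with hA
  have hAeval : ∀ w α : ℂ, (A w).eval α = hurwitzZetaC (-n - 1)
      ((α + w + Real.pi * I) / (2 * Real.pi * I)) := by
    intro w α
    rw [hs, hQ, hA]
    simp only [Polynomial.eval_comp, Polynomial.eval_mul, Polynomial.eval_C, Polynomial.eval_add,
      Polynomial.eval_X]
    congr 1
    rw [div_eq_inv_mul]
    ring
  set W : Polynomial ℂ := Polynomial.C ((2 * Real.pi * I) ^ (n + 2 : ℂ) / (n + 1 : ℂ)) *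
    (2 * A (log b) - A (2 * log b) - A 0) with hW
  have hWeval : ∀ α, W.eval α = hurwitzCombination n α (log b) := by
    intro α
    rw [hW, hurwitzCombination]
    simp only [Polynomial.eval_mul, Polynomial.eval_C, Polynomial.eval_sub, hAeval, add_zero,
      Polynomial.eval_ofNat]
  have hPeval : ∀ α : ℂ, ∫ t : ℝ, log (logRatio b (Real.exp t)) * (α + t) ^ (n : ℂ) = P.eval α := by
    intro α
    rw [← hP]
    simp only [cpow_natCast, mul_comm]
  -- Both sides are polynomials in α that agree on the upper half-plane, an infinite set; this
  -- reaches arg a < 0.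
  have hPW : P = W := by
    have hinj : Function.Injective fun z : ℂ => I * z := mul_right_injective₀ I_ne_zero
    refine Polynomial.eq_of_infinite_eval_eq _ _
      (((infinite_setOf_re_gt 0).image hinj.injOn).mono ?_)
    rintro _ ⟨z, hz, rfl⟩
    have hz' : 0 < z.re := hz
    have him : 0 < (I * z).im := by simpa using hz'
    simp only [mem_ofPred_eq]
    rw [← hPeval, hWeval]
    exact integral_log_logRatio_mul him.le (.inl him) hb0 hb
      (by exact_mod_cast n.succ_ne_zero) (by exact_mod_cast (n + 1).succ_ne_zero)
  rw [hPeval, hPW, hWeval]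

/-! ### The substitution x = e^t and the final form -/

theorem logIntegrand_exp {a : ℂ} (ha : a ≠ 0) (k b : ℂ) (t : ℝ) :
    |Real.exp t| • logIntegrand k a b (Real.exp t) =
      log (logRatio b (Real.exp t)) * (log a + t) ^ k := by
  have hx := Real.exp_pos t
  have hx' : (Real.exp t : ℂ) ≠ 0 := ofReal_ne_zero.mpr hx.ne'
  have hlog : log (a * (Real.exp t : ℂ)) = log a + t := by
    rw [mul_comm, log_ofReal_mul hx ha, Real.log_exp, add_comm]
  rw [logIntegrand, hlog, logRatio, abs_of_pos hx, real_smul]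
  field_simp

theorem image_exp_univ : Real.exp '' univ = Ioi 0 := by
  rw [image_univ, Real.range_exp]

theorem integrableOn_logIntegrand_iff {a : ℂ} (ha : a ≠ 0) (k b : ℂ) :
    IntegrableOn (logIntegrand k a b) (Ioi 0) ↔
      Integrable fun t : ℝ => log (logRatio b (Real.exp t)) * (log a + t) ^ k := by
  rw [← image_exp_univ, integrableOn_image_iff_integrableOn_abs_deriv_smul MeasurableSet.univ
    (fun t _ => (Real.hasDerivAt_exp t).hasDerivWithinAt) Real.exp_injective.injOn,
    integrableOn_univ]
  simp only [logIntegrand_exp ha]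

theorem integral_logIntegrand {a : ℂ} (ha : a ≠ 0) (k b : ℂ) :
    ∫ x in Ioi (0 : ℝ), logIntegrand k a b x =
      ∫ t : ℝ, log (logRatio b (Real.exp t)) * (log a + t) ^ k := by
  rw [← image_exp_univ, integral_image_eq_integral_abs_deriv_smul MeasurableSet.univ
    (fun t _ => (Real.hasDerivAt_exp t).hasDerivWithinAt) Real.exp_injective.injOn,
    setIntegral_univ]
  simp only [logIntegrand_exp ha]

theorem hurwitzCombination_eq (k α β : ℂ) :
    hurwitzCombination k α β =
      (2 : ℂ) ^ (k + 3) * (Complex.I * (Real.pi : ℂ)) ^ (k + 2)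
          * hurwitzZetaC (-k - 1)
              ((-Complex.I * α - Complex.I * β + (Real.pi : ℂ)) / (2 * (Real.pi : ℂ))) / (k + 1)
        - (2 * Complex.I * (Real.pi : ℂ)) ^ (k + 2)
          * hurwitzZetaC (-k - 1)
              ((-Complex.I * α - 2 * Complex.I * β + (Real.pi : ℂ)) / (2 * (Real.pi : ℂ))) / (k + 1)
        - (2 * Complex.I * (Real.pi : ℂ)) ^ (k + 2)
          * hurwitzZetaC (-k - 1)
              (((Real.pi : ℂ) - Complex.I * α) / (2 * (Real.pi : ℂ))) / (k + 1) := by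
  have hpi : (Real.pi : ℂ) ≠ 0 := ofReal_ne_zero.mpr Real.pi_ne_zero
  have hq : ∀ w : ℂ, (w + Real.pi * I) / (2 * Real.pi * I) =
      (-I * w + Real.pi) / (2 * Real.pi) := by
    intro w
    field_simp
    linear_combination w * I_sq
  -- The positive factor 2 passes through the principal logarithm, so 2^(k+2) (iπ)^(k+2) =
  -- (2iπ)^(k+2).
  have hpow : (2 : ℂ) ^ (k + 3) * (I * (Real.pi : ℂ)) ^ (k + 2) =
      2 * (2 * I * (Real.pi : ℂ)) ^ (k + 2) := by
    have hne : I * (Real.pi : ℂ) ≠ 0 := mul_ne_zero I_ne_zero hpi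
    have hlog : log (2 * (I * (Real.pi : ℂ))) = log 2 + log (I * (Real.pi : ℂ)) := by
      have := log_ofReal_mul (r := 2) two_pos hne
      rwa [ofReal_log zero_le_two, ofReal_ofNat] at this
    rw [show k + 3 = (k + 2) + 1 by ring, cpow_add _ _ two_ne_zero, cpow_one, mul_assoc 2 I,
      cpow_def_of_ne_zero two_ne_zero, cpow_def_of_ne_zero hne,
      cpow_def_of_ne_zero (mul_ne_zero two_ne_zero hne), hlog, add_mul, exp_add]
    ring
  have e1 : -I * α - I * β + Real.pi = -I * (α + β) + Real.pi := by ring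
  have e2 : -I * α - 2 * I * β + Real.pi = -I * (α + 2 * β) + Real.pi := by ring
  have e3 : (Real.pi : ℂ) - I * α = -I * α + Real.pi := by ring
  rw [hpow, e1, e2, e3, hurwitzCombination, hq, hq, hq,
    show (2 * I * (Real.pi : ℂ)) = 2 * Real.pi * I by ring]
  ring

theorem theorem3p5 (k a b : ℂ) (hk1 : k ≠ -1) (hk2 : k ≠ -2)
    (hb : b ≠ 0) (hb' : 0 ≤ b.re) (ha : a ≠ 0)
    (hak : 0 < a.arg ∨ (a.arg = 0 ∧ -1 < k.re) ∨ ∃ n : ℕ, k = (n : ℂ)) :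
    MeasureTheory.IntegrableOn (logIntegrand k a b) (Set.Ioi (0 : ℝ)) ∧
    ∫ x in Set.Ioi (0 : ℝ), logIntegrand k a b x =
      (2 : ℂ) ^ (k + 3) * (Complex.I * (Real.pi : ℂ)) ^ (k + 2)
          * hurwitzZetaC (-k - 1)
              ((-Complex.I * Complex.log a - Complex.I * Complex.log b + (Real.pi : ℂ))
                / (2 * (Real.pi : ℂ))) / (k + 1)
        - (2 * Complex.I * (Real.pi : ℂ)) ^ (k + 2)
          * hurwitzZetaC (-k - 1)
              ((-Complex.I * Complex.log a - 2 * Complex.I * Complex.log b + (Real.pi : ℂ))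
                / (2 * (Real.pi : ℂ))) / (k + 1)
        - (2 * Complex.I * (Real.pi : ℂ)) ^ (k + 2)
          * hurwitzZetaC (-k - 1)
              (((Real.pi : ℂ) - Complex.I * Complex.log a) / (2 * (Real.pi : ℂ))) / (k + 1) := by
  have hk1' : k + 1 ≠ 0 := fun h => hk1 (eq_neg_of_add_eq_zero_left h)
  have hk2' : k + 2 ≠ 0 := fun h => hk2 (eq_neg_of_add_eq_zero_left h)
  rw [integrableOn_logIntegrand_iff ha, integral_logIntegrand ha, ← hurwitzCombination_eq]
  rcases hak with h | ⟨h, hk⟩ | ⟨n, rfl⟩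
  · have him : 0 < (log a).im := by rwa [log_im]
    exact ⟨integrable_log_logRatio_mul (.inl him) hb hb',
      integral_log_logRatio_mul him.le (.inl him) hb hb' hk1' hk2'⟩
  · have him : (log a).im = 0 := by rwa [log_im]
    exact ⟨integrable_log_logRatio_mul (.inr hk) hb hb',
      integral_log_logRatio_mul him.ge (.inr hk) hb hb' hk1' hk2'⟩
  · refine ⟨integrable_log_logRatio_mul (.inr ?_) hb hb',
      integral_log_logRatio_mul_natCast hb hb' n _⟩
    rw [natCast_re]
    linarith [(Nat.cast_nonneg n : (0 : ℝ) ≤ n)]
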